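/- Let $d\in\mathbb N$, $p\in[1,2]$, $\lambda>0$, $\alpha>0$, $E\in[0,\infty)$, $d'>d$ and $\lambda'<\lambda$ be given (with $d',\lambda'$ real). Then there is an integer $N_0\ge 1$, depending only on these parameters $(d,p,\lambda,\alpha,E,d',\lambda')$, with the following property. Let $\{X^i\}_{i\ge1}$ be independent (not necessarily identically distributed) $\mathbb R^d$-valued random variables on a probability space $(\Omega,\mathcal F,\mathbb P)$, and write $$\hat\mu^n:=\frac1n\sum_{i=1}^n\delta_{X^i},\qquad \mu_i:=\mathrm{Law}(X^i),\qquad \mu^n:=\frac1n\sum_{i=1}^n\mu_i .$$ Suppose that $E_\alpha:=\sup_{i}\int_{\mathbb R^d}e^{\alpha|x|^2}\,\mu_i(dx)=E<\infty$, and that for each $n\ge1$ the measure $\mu^n$ satisfies the Talagrand $T_p(\lambda)$ inequality, i.e. $$W_p(\nu,\mu^n)\le\sqrt{\tfrac2\lambda\,H(\nu\,\|\,\mu^n)}\qquad\text{for every Borel probability measure }\nu\text{ on }\mathbb R^d .$$ Then for every $\varepsilon>0$ and every integer $n\ge N_0\max(\varepsilon^{-(d'+2)},1)$, $$\mathbb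 P\big(W_p(\hat\mu^n,\mu^n)>\varepsilon\big)\le\exp\Big(-\gamma_p\,\frac{\lambda'}2\,n\varepsilon^2\Big),\qquad \gamma_p=\begin{cases}1,&1\le p<2,\\ 3-2\sqrt2,&p=2.\end{cases}$$ Here $|\cdot|$ is the Euclidean norm, $W_p(m_1,m_2)=\big(\inf_\pi\int|x-y|^p\,\pi(dx\,dy)\big)^{1/p}$ with the infimum over all probability measures $\pi$ on $\mathbb R^d\times\mathbb R^d$ with marginals $m_1,m_2$, and $H(\nu\|\mu)=\int\log\frac{d\nu}{d\mu}\,d\nu$ if $\nu\ll\mu$ and $+\infty$ otherwise (relative entropy). -/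

import Mathlib

open MeasureTheory ProbabilityTheory
open scoped ENNReal NNReal

noncomputable section

/-- `IsCoupling π μ ν`: the measure `π` on the product space has marginals `μ` and `ν`.
If `μ` is a probability measure, then so is `π`. -/
def IsCoupling {S : Type*} [MeasurableSpace S] (π : Measure (S × S)) (μ ν : Measure S) : Prop :=
  π.map Prod.fst = μ ∧ π.map Prod.snd = ν

/-- The Wasserstein distance of order `p`, with values in `[0, ∞]`:
`W_p(μ, ν) = (inf_π ∫ |x - y|^p π(dx dy))^(1/p)`, the infimum being over all couplings. -/
def wassersteinDist {S : Type*} [MeasurableSpace S] [PseudoEMetricSpace S]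
    (p : ℝ) (μ ν : Measure S) : ℝ≥0∞ :=
  (⨅ (π : Measure (S × S)) (_ : IsCoupling π μ ν), ∫⁻ z, edist z.1 z.2 ^ p ∂π) ^ (1 / p)

/-- The Talagrand inequality `T_p(lam)`: `W_p(ν, μ) ≤ √((2 / lam) H(ν ‖ μ))` for every
probability measure `ν`, where the relative entropy `H` may be infinite. -/
def SatisfiesTalagrand {S : Type*} [MeasurableSpace S] [PseudoEMetricSpace S]
    (p lam : ℝ) (μ : Measure S) : Prop :=
  ∀ ν : Measure S, IsProbabilityMeasure ν →
    wassersteinDist p ν μ ≤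
      (ENNReal.ofReal (2 / lam) * InformationTheory.klDiv ν μ) ^ (1 / 2 : ℝ)

/-- The empirical measure `n⁻¹ ∑_{i < n} δ_{x i}` of the first `n` points of a sequence. -/
def empiricalMeasure {S : Type*} [MeasurableSpace S] (n : ℕ) (x : ℕ → S) : Measure S :=
  (n : ℝ≥0∞)⁻¹ • ∑ i ∈ Finset.range n, Measure.dirac (x i)

/-- The averaged law `n⁻¹ ∑_{i < n} Law(X i)` of the first `n` variables of a sequence. -/
def averagedLaw {Ω S : Type*} [MeasurableSpace Ω] [MeasurableSpace S]
    (P : Measure Ω) (n : ℕ) (X : ℕ → Ω → S) : Measure S :=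
  (n : ℝ≥0∞)⁻¹ • ∑ i ∈ Finset.range n, P.map (X i)

/-- `E_α = sup_i ∫ exp(α |x|²) Law(X i)(dx)`, with values in `[0, ∞]`. -/
def sqExpMoment {Ω S : Type*} [MeasurableSpace Ω] [MeasurableSpace S] [Norm S]
    (P : Measure Ω) (α : ℝ) (X : ℕ → Ω → S) : ℝ≥0∞ :=
  ⨆ i, ∫⁻ x, ENNReal.ofReal (Real.exp (α * ‖x‖ ^ 2)) ∂(P.map (X i))

/-- The constant `γ_p`, used for `1 ≤ p ≤ 2`: it is `1` for `p < 2` and `3 - 2√2` for `p = 2`. -/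
def gammaConst (p : ℝ) : ℝ :=
  if p < 2 then 1 else 3 - 2 * Real.sqrt 2

end

/-! The argument is the method of types. Cut the space into the exterior of a ball of radius `R`
(the cell `o`) and finitely many small cells covering the ball. The type of a sample is its vector
of cell counts; there are at most `(n + 1) ^ |J|` types. Resample the points: one in a small cell is
redistributed according to `μ` conditioned on that cell, an outer one according to `μ` itself. This
costs the cell diameter plus terms controlled by the `p`-th moment of the outer points
(`wassersteinDist_resampledMeasure_le`). The resampled measure has a density with respect to `μ`
that depends only on the type, and its entropy is at most the inner log-likelihood `I`, the sum of
`t c * log (density)` over `c ≠ o` (`sum_cellDensity_mul_log_le`). Talagrand's inequality then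
bounds its distance to `μ` by `√(2 I / lam)`. So a deviation beyond `ε` forces either a large outer
moment or a type with large `I`.

Both events are handled by Chernoff bounds. A given type has probability at most `exp (-n (I - m))`,
with `m` the mass of the exterior (`measure_occupation_eq_le`); the outer moment is tested against
`exp (θ |x|²)` (`measure_lt_outerMoment_le`). Unequal laws do no harm: by AM-GM the product of
expectations is at most the `n`-th power of the integral against the averaged law. For `p < 2` a
large `R` makes any `θ > 0` sufficient; for `p = 2` it does not, and a `θ` close to `lam / 2` is
supplied by the Talagrand inequality itself (`lintegral_exp_sq_le`).

With `R` of order `1 + ε + log (1 + 1/ε)` the Gaussian tail is small against `ε²`. The number of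
cells is of order `ε ^ (-d)` up to logarithms for small `ε`, so the entropy of the set of types is
negligible against `n ε²`; the gap `d' - d` pays for the logarithms. -/

/-! ### Couplings and the Wasserstein triangle inequality. -/

section Wasserstein

lemma wassersteinDist_eq_iInf {S : Type*} [MeasurableSpace S] [PseudoEMetricSpace S]
    {p : ℝ} (hp : 1 ≤ p) (μ ν : Measure S) :
    wassersteinDist p μ ν =
      ⨅ (π : Measure (S × S)) (_ : IsCoupling π μ ν),
        (∫⁻ z, edist z.1 z.2 ^ p ∂π) ^ (1 / p) := by
  have h : 0 < 1 / p := by positivity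
  have := (ENNReal.orderIsoRpow (1 / p) h).map_iInf₂
    (fun (π : Measure (S × S)) (_ : IsCoupling π μ ν) => ∫⁻ z, edist z.1 z.2 ^ p ∂π)
  exact this

lemma wassersteinDist_le_of_isCoupling {S : Type*} [MeasurableSpace S] [PseudoEMetricSpace S]
    {p : ℝ} (hp : 1 ≤ p) {μ ν : Measure S} {π : Measure (S × S)} (hπ : IsCoupling π μ ν) :
    wassersteinDist p μ ν ≤ (∫⁻ z, edist z.1 z.2 ^ p ∂π) ^ (1 / p) := by
  rw [wassersteinDist_eq_iInf hp]
  exact iInf₂_le π hπ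

variable {S : Type*} [NormedAddCommGroup S] [MeasurableSpace S] [BorelSpace S]
  [SecondCountableTopology S]

/-- Gluing of two couplings along their common marginal. -/
lemma exists_isCoupling_glue [CompleteSpace S] {p : ℝ} (hp : 1 ≤ p) {μ₁ μ₂ μ₃ : Measure S}
    [IsFiniteMeasure μ₂] {π π' : Measure (S × S)}
    (hπ : IsCoupling π μ₁ μ₂) (hπ' : IsCoupling π' μ₂ μ₃) :
    ∃ ρ : Measure (S × S), IsCoupling ρ μ₁ μ₃ ∧
      (∫⁻ z, edist z.1 z.2 ^ p ∂ρ) ^ (1 / p) ≤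
        (∫⁻ z, edist z.1 z.2 ^ p ∂π) ^ (1 / p) + (∫⁻ z, edist z.1 z.2 ^ p ∂π') ^ (1 / p) := by
  have hπ'fin : IsFiniteMeasure π' := by
    constructor
    have : π' Set.univ = μ₂ Set.univ := by
      rw [← hπ'.1, Measure.map_apply measurable_fst MeasurableSet.univ, Set.preimage_univ]
    rw [this]; exact measure_lt_top _ _
  have hπfin : IsFiniteMeasure π := by
    constructor
    have : π Set.univ = μ₂ Set.univ := by
      rw [← hπ.2, Measure.map_apply measurable_snd MeasurableSet.univ, Set.preimage_univ]
    rw [this]; exact measure_lt_top _ _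
  -- Given `(x, y)` drawn from `π`, the third point is drawn from the conditional law of `π'` given
  -- its first coordinate `y`.
  let κ : Kernel (S × S) S := π'.condKernel.comap Prod.snd measurable_snd
  let τ : Measure ((S × S) × S) := π ⊗ₘ κ
  have h12 : τ.map Prod.fst = π := Measure.fst_compProd π κ
  have h23 : τ.map (fun z => (z.1.2, z.2)) = π' := by
    have hm : Measurable (fun z : (S × S) × S => (z.1.2, z.2)) := by fun_prop
    have e : π' = μ₂ ⊗ₘ π'.condKernel := by
      conv_lhs => rw [← π'.disintegrate π'.condKernel]
      rw [← hπ'.1]; rfl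
    conv_rhs => rw [e]
    refine Measure.ext_of_lintegral _ fun f hf => ?_
    rw [lintegral_map hf hm]
    simp only [τ]
    rw [Measure.lintegral_compProd (f := fun a : (S × S) × S => f (a.1.2, a.2)) (hf.comp hm),
      Measure.lintegral_compProd hf, ← hπ.2, lintegral_map _ measurable_snd]
    · rfl
    · exact hf.lintegral_kernel_prod_right'
  refine ⟨τ.map (fun z => (z.1.1, z.2)), ⟨?_, ?_⟩, ?_⟩
  · rw [Measure.map_map measurable_fst (by fun_prop), ← hπ.1, ← h12,
      Measure.map_map measurable_fst measurable_fst]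
    rfl
  · rw [Measure.map_map measurable_snd (by fun_prop), ← hπ'.2, ← h23,
      Measure.map_map measurable_snd (by fun_prop)]
    rfl
  · conv_rhs => rw [← h12, ← h23]
    rw [lintegral_map (by fun_prop) (by fun_prop), lintegral_map (by fun_prop) (by fun_prop),
      lintegral_map (by fun_prop) (by fun_prop)]
    refine le_trans ?_ (ENNReal.lintegral_Lp_add_le (μ := τ) (p := p)
      (f := fun z => edist z.1.1 z.1.2) (g := fun z => edist z.1.2 z.2)
      (by fun_prop) (by fun_prop) hp)
    gcongr with z
    exact edist_triangle _ _ _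

lemma wassersteinDist_triangle [CompleteSpace S] {p : ℝ} (hp : 1 ≤ p) (μ₁ μ₂ μ₃ : Measure S)
    [IsFiniteMeasure μ₂] :
    wassersteinDist p μ₁ μ₃ ≤ wassersteinDist p μ₁ μ₂ + wassersteinDist p μ₂ μ₃ := by
  rw [wassersteinDist_eq_iInf hp μ₁ μ₂, wassersteinDist_eq_iInf hp μ₂ μ₃]
  refine ENNReal.le_iInf₂_add_iInf₂ fun π hπ π' hπ' => ?_
  obtain ⟨ρ, hρ, h⟩ := exists_isCoupling_glue hp hπ hπ'
  exact (wassersteinDist_le_of_isCoupling hp hρ).trans h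

/-- The `L^p` norm of a function dominated by the norm, under two measures. -/
lemma lintegral_rpow_le_wassersteinDist_add {p : ℝ} (hp : 1 ≤ p) (ν μ : Measure S)
    {ψ : S → ℝ≥0∞} (hψ : Measurable ψ) (hψle : ∀ x, ψ x ≤ ‖x‖ₑ) :
    (∫⁻ x, ψ x ^ p ∂ν) ^ (1 / p) ≤
      wassersteinDist p ν μ + (∫⁻ x, ‖x‖ₑ ^ p ∂μ) ^ (1 / p) := by
  rw [wassersteinDist_eq_iInf hp, ENNReal.iInf₂_add]
  refine le_iInf₂ fun π hπ => ?_
  conv_rhs => rw [← hπ.2]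
  conv_lhs => rw [← hπ.1]
  rw [lintegral_map (by fun_prop) (by fun_prop), lintegral_map (by fun_prop) (by fun_prop)]
  refine le_trans ?_ (ENNReal.lintegral_Lp_add_le (μ := π) (p := p)
      (f := fun z => edist z.1 z.2) (g := fun z => ‖z.2‖ₑ) (by fun_prop) (by fun_prop) hp)
  gcongr with z
  refine (hψle _).trans ?_
  simp only [Pi.add_apply]
  rw [← edist_zero_right, ← edist_zero_right]
  exact edist_triangle _ _ _

end Wasserstein

/-! ### Relative entropy of a measure given by a density. -/

section Entropy

variable {S : Type*} [MeasurableSpace S]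

lemma integrable_of_bounded {μ : Measure S} [IsFiniteMeasure μ] {f : S → ℝ} (hf : Measurable f)
    (hb : ∃ C, ∀ x, |f x| ≤ C) : Integrable f μ := by
  obtain ⟨C, hC⟩ := hb
  exact Integrable.of_bound hf.aestronglyMeasurable C (ae_of_all _ hC)

lemma isProbabilityMeasure_withDensity_ofReal {μ : Measure S} {f : S → ℝ} (hf0 : ∀ x, 0 ≤ f x)
    (hfi : Integrable f μ) (h1 : ∫ x, f x ∂μ = 1) :
    IsProbabilityMeasure (μ.withDensity fun x => ENNReal.ofReal (f x)) := by
  constructor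
  rw [withDensity_apply _ MeasurableSet.univ, Measure.restrict_univ,
    ← ofReal_integral_eq_lintegral_ofReal hfi (ae_of_all _ hf0), h1, ENNReal.ofReal_one]

/-- The relative entropy of a probability measure given by a density. -/
lemma klDiv_withDensity_ofReal {μ : Measure S} [IsProbabilityMeasure μ] {f : S → ℝ}
    (hf : Measurable f) (hf0 : ∀ x, 0 ≤ f x) (hfi : Integrable f μ) (h1 : ∫ x, f x ∂μ = 1)
    (hi : Integrable (fun x => f x * Real.log (f x)) μ) :
    InformationTheory.klDiv (μ.withDensity fun x => ENNReal.ofReal (f x)) μ =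
      ENNReal.ofReal (∫ x, f x * Real.log (f x) ∂μ) := by
  have hP := isProbabilityMeasure_withDensity_ofReal hf0 hfi h1
  have hac : (μ.withDensity fun x => ENNReal.ofReal (f x)) ≪ μ := withDensity_absolutelyContinuous _ _
  have hrn : (μ.withDensity fun x => ENNReal.ofReal (f x)).rnDeriv μ =ᵐ[μ]
      fun x => ENNReal.ofReal (f x) := Measure.rnDeriv_withDensity _ hf.ennreal_ofReal
  have hcongr : (fun x => ((μ.withDensity fun x => ENNReal.ofReal (f x)).rnDeriv μ x).toReal *
      Real.log ((μ.withDensity fun x => ENNReal.ofReal (f x)).rnDeriv μ x).toReal) =ᵐ[μ]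
      fun x => f x * Real.log (f x) := by
    filter_upwards [hrn] with x hx
    rw [hx, ENNReal.toReal_ofReal (hf0 x)]
  rw [InformationTheory.klDiv_of_ac_of_integrable hac, ← integral_congr_ae hcongr]
  · rw [integral_rnDeriv_mul_log hac]
    simp
  · rw [← integrable_rnDeriv_mul_log_iff hac]
    exact hi.congr hcongr.symm

end Entropy

/-! ### Chernoff bounds for independent, not identically distributed variables. -/

section Chernoff

/-- AM-GM. Applied to the expectations of `g (X i)`, it lets the averaged law stand in for a common
law. -/
lemma ENNReal.prod_range_le_avg_pow {n : ℕ} (hn : n ≠ 0) (z : ℕ → ℝ≥0∞) :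
    ∏ i ∈ Finset.range n, z i ≤ ((n : ℝ≥0∞)⁻¹ * ∑ i ∈ Finset.range n, z i) ^ n := by
  by_cases htop : ∃ i ∈ Finset.range n, z i = ∞
  · have : ∑ i ∈ Finset.range n, z i = ∞ := ENNReal.sum_eq_top.2 htop
    rw [this, ENNReal.mul_top (by simp), ENNReal.top_pow hn]
    exact le_top
  push Not at htop
  have hz : ∀ i ∈ Finset.range n, z i = ((z i).toNNReal : ℝ≥0∞) := fun i hi =>
    (ENNReal.coe_toNNReal (htop i hi)).symm
  rw [Finset.prod_congr rfl hz, Finset.sum_congr rfl hz]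
  have hn' : (n : ℝ≥0) ≠ 0 := by exact_mod_cast hn
  have key := NNReal.geom_mean_le_arith_mean_weighted (Finset.range n) (fun _ => (n : ℝ≥0)⁻¹)
    (fun i => (z i).toNNReal) (by simp [hn'])
  have key2 := pow_le_pow_left' key n
  rw [← Finset.prod_pow, ← Finset.mul_sum] at key2
  have e : ∀ i ∈ Finset.range n, ((z i).toNNReal ^ (((n : ℝ≥0)⁻¹ : ℝ≥0) : ℝ)) ^ n = (z i).toNNReal := by
    intro i _
    rw [NNReal.coe_inv, NNReal.coe_natCast, NNReal.rpow_inv_natCast_pow _ hn]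
  rw [Finset.prod_congr rfl e] at key2
  have h3 : (n : ℝ≥0∞)⁻¹ = (((n : ℝ≥0)⁻¹ : ℝ≥0) : ℝ≥0∞) := by
    rw [ENNReal.coe_inv hn', ENNReal.coe_natCast]
  rw [h3]
  exact_mod_cast key2

variable {Ω S : Type*} [MeasurableSpace Ω] [MeasurableSpace S] {P : Measure Ω}
  {X : ℕ → Ω → S} {n : ℕ}

lemma lintegral_averagedLaw (hX : ∀ i, Measurable (X i)) {g : S → ℝ≥0∞} (hg : Measurable g) :
    ∫⁻ x, g x ∂(averagedLaw P n X) =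
      (n : ℝ≥0∞)⁻¹ * ∑ i ∈ Finset.range n, ∫⁻ ω, g (X i ω) ∂P := by
  rw [averagedLaw, lintegral_smul_measure, lintegral_finsetSum_measure, smul_eq_mul]
  congr 1
  exact Finset.sum_congr rfl fun i _ => lintegral_map hg (hX i)

lemma averagedLaw_apply (hX : ∀ i, Measurable (X i)) {s : Set S} (hs : MeasurableSet s) :
    averagedLaw P n X s = (n : ℝ≥0∞)⁻¹ * ∑ i ∈ Finset.range n, P (X i ⁻¹' s) := by
  rw [averagedLaw, Measure.smul_apply, Measure.finsetSum_apply, smul_eq_mul]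
  congr 1
  exact Finset.sum_congr rfl fun i _ => Measure.map_apply (hX i) hs

lemma isProbabilityMeasure_averagedLaw [IsProbabilityMeasure P] (hX : ∀ i, Measurable (X i))
    (hn : n ≠ 0) : IsProbabilityMeasure (averagedLaw P n X) := by
  constructor
  rw [averagedLaw_apply hX MeasurableSet.univ]
  simp only [Set.preimage_univ, measure_univ, Finset.sum_const, Finset.card_range,
    nsmul_eq_mul, mul_one]
  exact ENNReal.inv_mul_cancel (by exact_mod_cast hn) (ENNReal.natCast_ne_top n)

/-- Chernoff's bound for a product of functions of independent variables. -/
lemma measure_mul_le_lintegral_averagedLaw_pow (hX : ∀ i, Measurable (X i)) (hind : iIndepFun X P)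
    (hn : n ≠ 0) {g : S → ℝ≥0∞} (hg : Measurable g) (c : ℝ≥0∞) :
    P {ω | c ≤ ∏ i ∈ Finset.range n, g (X i ω)} * c ≤
      (∫⁻ x, g x ∂(averagedLaw P n X)) ^ n := by
  have hind' : iIndepFun (fun i ω => g (X i ω)) P := hind.comp (fun _ => g) (fun _ => hg)
  have hm : ∀ i, Measurable fun ω => g (X i ω) := fun i => hg.comp (hX i)
  calc P {ω | c ≤ ∏ i ∈ Finset.range n, g (X i ω)} * c
      ≤ ∫⁻ ω, ∏ i ∈ Finset.range n, g (X i ω) ∂P := by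
        rw [mul_comm]
        exact mul_meas_ge_le_lintegral (Finset.measurable_prod _ fun i _ => hm i) c
    _ = ∏ i ∈ Finset.range n, ∫⁻ ω, g (X i ω) ∂P :=
        lintegral_prod_eq_prod_lintegral_of_indepFun _ _ hind' hm
    _ ≤ _ := by
        rw [lintegral_averagedLaw hX hg]
        exact ENNReal.prod_range_le_avg_pow hn _

/-- Chernoff's bound in exponential form. -/
lemma measure_le_exp_of_chernoff (hX : ∀ i, Measurable (X i)) (hind : iIndepFun X P)
    (hn : n ≠ 0) {g : S → ℝ≥0∞} (hg : Measurable g) {A : Set Ω} {u v : ℝ}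
    (hA : ∀ ω ∈ A, ENNReal.ofReal (Real.exp (n * u)) ≤ ∏ i ∈ Finset.range n, g (X i ω))
    (hv : ∫⁻ x, g x ∂(averagedLaw P n X) ≤ ENNReal.ofReal (1 + v)) (hv0 : 0 ≤ v) :
    P A ≤ ENNReal.ofReal (Real.exp (-(n * (u - v)))) := by
  have h1 : P A * ENNReal.ofReal (Real.exp (n * u)) ≤ ENNReal.ofReal (Real.exp (n * v)) := by
    calc P A * ENNReal.ofReal (Real.exp (n * u))
        ≤ P {ω | ENNReal.ofReal (Real.exp (n * u)) ≤ ∏ i ∈ Finset.range n, g (X i ω)} *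
          ENNReal.ofReal (Real.exp (n * u)) := by gcongr; exact hA
      _ ≤ _ := measure_mul_le_lintegral_averagedLaw_pow hX hind hn hg _
      _ ≤ (ENNReal.ofReal (1 + v)) ^ n := by gcongr
      _ = ENNReal.ofReal ((1 + v) ^ n) := (ENNReal.ofReal_pow (by linarith) n).symm
      _ ≤ ENNReal.ofReal (Real.exp v ^ n) := by
          gcongr
          linarith [Real.add_one_le_exp v]
      _ = _ := by rw [← Real.exp_nat_mul]
  have h2 : P A = P A * ENNReal.ofReal (Real.exp (n * u)) * ENNReal.ofReal (Real.exp (-(n * u))) := by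
    rw [mul_assoc, ← ENNReal.ofReal_mul (Real.exp_pos _).le, ← Real.exp_add]
    simp
  rw [h2]
  calc _ ≤ ENNReal.ofReal (Real.exp (n * v)) * ENNReal.ofReal (Real.exp (-(n * u))) := by gcongr
    _ = _ := by
      rw [← ENNReal.ofReal_mul (Real.exp_pos _).le, ← Real.exp_add]
      congr 2; ring

end Chernoff

/-! ### Cell counts, and the resampled measure with its entropy. -/

section Cells

variable {S J : Type*} [Fintype J] [DecidableEq J]

/-- The number of indices `i < n` with `a i = c`. -/
def occupation (n : ℕ) (a : ℕ → J) (c : J) : ℕ := {i ∈ Finset.range n | a i = c}.card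

omit [Fintype J] in
lemma occupation_le (n : ℕ) (a : ℕ → J) (c : J) : occupation n a c ≤ n := by
  simpa [occupation] using Finset.card_filter_le (Finset.range n) (fun i => a i = c)

lemma sum_range_eq_sum_occupation (n : ℕ) (a : ℕ → J) (f : J → ℝ) :
    ∑ i ∈ Finset.range n, f (a i) = ∑ c, occupation n a c * f c := by
  rw [← Finset.sum_fiberwise' (Finset.range n) a f]
  simp [occupation]

lemma prod_range_eq_prod_occupation (n : ℕ) (a : ℕ → J) (f : J → ℝ) :
    ∏ i ∈ Finset.range n, f (a i) = ∏ c, f c ^ occupation n a c := by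
  rw [← Finset.prod_fiberwise' (Finset.range n) a f]
  simp [occupation]

lemma sum_occupation (n : ℕ) (a : ℕ → J) : ∑ c, (occupation n a c : ℝ) = n := by
  simpa using (sum_range_eq_sum_occupation n a fun _ => 1).symm

omit [Fintype J] in
lemma occupation_pos_of_lt {n i : ℕ} (hi : i < n) (a : ℕ → J) : 0 < occupation n a (a i) :=
  Finset.card_pos.2 ⟨i, by simp [hi]⟩

omit [Fintype J] in
lemma exists_of_occupation_pos {n : ℕ} {a : ℕ → J} {c : J} (h : 0 < occupation n a c) :
    ∃ i < n, a i = c := by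
  obtain ⟨i, hi⟩ := Finset.card_pos.1 h
  exact ⟨i, by simpa using hi⟩

variable [MeasurableSpace S] {q : S → J}

omit [DecidableEq J] in
lemma measurable_comp_of_fibers {β : Type*} [MeasurableSpace β]
    (hq : ∀ c, MeasurableSet (q ⁻¹' {c})) (f : J → β) : Measurable fun x => f (q x) := by
  let _ : MeasurableSpace J := ⊤
  exact measurable_from_top.comp (measurable_to_countable' hq)

omit [DecidableEq J] in
lemma integral_comp_cells {μ : Measure S} [IsFiniteMeasure μ]
    (hq : ∀ c, MeasurableSet (q ⁻¹' {c})) (f : J → ℝ) :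
    ∫ x, f (q x) ∂μ = ∑ c, μ.real (q ⁻¹' {c}) * f c := by
  let _ : MeasurableSpace J := ⊤
  have hqm : Measurable q := measurable_to_countable' hq
  rw [← integral_map hqm.aemeasurable measurable_from_top.aestronglyMeasurable,
    integral_fintype _]
  · refine Finset.sum_congr rfl fun c _ => ?_
    rw [map_measureReal_apply hqm trivial, smul_eq_mul]
  · exact Integrable.of_finite

/-- The density, as a function of the cell, of the measure obtained from a measure with cell
masses `m` by giving the cells `c ≠ o` the masses `t c` and spreading the mass `t o` over the whole
measure. -/
noncomputable def cellDensity (o : J) (t m : J → ℝ) (c : J) : ℝ :=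
  t o + if c = o then 0 else t c / m c

omit [Fintype J] in
lemma cellDensity_nonneg {o : J} {t m : J → ℝ} (ht : ∀ c, 0 ≤ t c) (hm : ∀ c, 0 ≤ m c) (c : J) :
    0 ≤ cellDensity o t m c := by
  unfold cellDensity
  have := div_nonneg (ht c) (hm c)
  split_ifs <;> linarith [ht o]

/-- Integration of a function of the cell: the mass `t o` sees the `μ`-average, every other mass its
own cell. Admissibility is needed because `t c / m c` is `0` on a null cell and would lose the mass
`t c`. -/
lemma sum_mul_cellDensity {o : J} {t m : J → ℝ}
    (hadm : ∀ c, c ≠ o → m c = 0 → t c = 0) (φ : J → ℝ) :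
    ∑ c, m c * (cellDensity o t m c * φ c) =
      t o * (∑ c, m c * φ c) + ∑ c, (if c = o then 0 else t c * φ c) := by
  rw [Finset.mul_sum, ← Finset.sum_add_distrib]
  refine Finset.sum_congr rfl fun c _ => ?_
  unfold cellDensity
  split_ifs with h
  · ring
  · by_cases hm : m c = 0
    · rw [hm, hadm c h hm]; ring
    · field_simp

lemma sum_mul_cellDensity_eq_one {o : J} {t m : J → ℝ} (hm1 : ∑ c, m c = 1) (ht1 : ∑ c, t c = 1)
    (hadm : ∀ c, c ≠ o → m c = 0 → t c = 0) : ∑ c, m c * cellDensity o t m c = 1 := by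
  have h := sum_mul_cellDensity hadm (fun _ => 1)
  simp only [mul_one, hm1] at h
  rw [h, ← ht1, Finset.sum_ite, Finset.sum_const_zero, zero_add,
    ← Finset.add_sum_erase _ _ (Finset.mem_univ o)]
  congr 2
  ext c; simp

/-- The entropy of the measure described by `cellDensity` is at most the inner log-likelihood. -/
lemma sum_cellDensity_mul_log_le {o : J} {t m : J → ℝ} (ht : ∀ c, 0 ≤ t c) (hm : ∀ c, 0 ≤ m c)
    (hm1 : ∑ c, m c = 1) (ht1 : ∑ c, t c = 1) (hadm : ∀ c, c ≠ o → m c = 0 → t c = 0) :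
    ∑ c, m c * (cellDensity o t m c * Real.log (cellDensity o t m c)) ≤
      ∑ c, (if c = o then 0 else t c * Real.log (cellDensity o t m c)) := by
  rw [sum_mul_cellDensity hadm]
  -- The part of the entropy due to the outer mass is nonpositive by Jensen, in the form `log x ≤ x
  -- - 1`. The case `t o = 0` is separate since the density may then vanish, where that inequality
  -- fails for `Real.log 0 = 0`.
  suffices t o * ∑ c, m c * Real.log (cellDensity o t m c) ≤ 0 by linarith
  rcases (ht o).eq_or_lt with h0 | h0
  · simp [← h0]
  refine mul_nonpos_of_nonneg_of_nonpos h0.le ?_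
  calc ∑ c, m c * Real.log (cellDensity o t m c)
      ≤ ∑ c, m c * (cellDensity o t m c - 1) := by
        refine Finset.sum_le_sum fun c _ => mul_le_mul_of_nonneg_left ?_ (hm c)
        refine Real.log_le_sub_one_of_pos ?_
        unfold cellDensity
        have := div_nonneg (ht c) (hm c)
        split_ifs <;> linarith
    _ = 0 := by
        simp only [mul_sub, mul_one, Finset.sum_sub_distrib, hm1,
          sum_mul_cellDensity_eq_one hm1 ht1 hadm, sub_self]

omit [DecidableEq J] in
lemma sum_measureReal_cells {μ : Measure S} [IsProbabilityMeasure μ]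
    (hq : ∀ c, MeasurableSet (q ⁻¹' {c})) : ∑ c, μ.real (q ⁻¹' {c}) = 1 := by
  have := integral_comp_cells (μ := μ) hq (fun _ => 1)
  simpa using this.symm

omit [DecidableEq J] in
lemma integrable_comp_cells {μ : Measure S} [IsFiniteMeasure μ]
    (hq : ∀ c, MeasurableSet (q ⁻¹' {c})) (f : J → ℝ) : Integrable (fun x => f (q x)) μ := by
  refine integrable_of_bounded (measurable_comp_of_fibers hq f) ⟨∑ c, |f c|, fun x => ?_⟩
  exact Finset.single_le_sum (f := fun c => |f c|) (fun c _ => abs_nonneg _) (Finset.mem_univ (q x))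

lemma klDiv_cellDensity_le {μ : Measure S} [IsProbabilityMeasure μ]
    (hq : ∀ c, MeasurableSet (q ⁻¹' {c})) {o : J} {t : J → ℝ} (ht : ∀ c, 0 ≤ t c)
    (ht1 : ∑ c, t c = 1) (hadm : ∀ c, c ≠ o → μ.real (q ⁻¹' {c}) = 0 → t c = 0) :
    IsProbabilityMeasure (μ.withDensity fun x =>
        ENNReal.ofReal (cellDensity o t (fun c => μ.real (q ⁻¹' {c})) (q x))) ∧
      InformationTheory.klDiv (μ.withDensity fun x =>
        ENNReal.ofReal (cellDensity o t (fun c => μ.real (q ⁻¹' {c})) (q x))) μ ≤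
        ENNReal.ofReal (∑ c, (if c = o then 0 else
          t c * Real.log (cellDensity o t (fun c => μ.real (q ⁻¹' {c})) c))) := by
  set m : J → ℝ := fun c => μ.real (q ⁻¹' {c})
  have hm : ∀ c, 0 ≤ m c := fun c => measureReal_nonneg
  have hm1 : ∑ c, m c = 1 := sum_measureReal_cells hq
  have hf0 : ∀ x, 0 ≤ cellDensity o t m (q x) := fun x => cellDensity_nonneg ht hm _
  have hf1 : ∫ x, cellDensity o t m (q x) ∂μ = 1 := by
    rw [integral_comp_cells hq]
    exact sum_mul_cellDensity_eq_one hm1 ht1 hadm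
  have hfi : Integrable (fun x => cellDensity o t m (q x)) μ := integrable_comp_cells hq _
  refine ⟨isProbabilityMeasure_withDensity_ofReal hf0 hfi hf1, ?_⟩
  rw [klDiv_withDensity_ofReal (measurable_comp_of_fibers hq _) hf0 hfi hf1
    (integrable_comp_cells hq fun c => cellDensity o t m c * Real.log (cellDensity o t m c)),
    integral_comp_cells hq fun c => cellDensity o t m c * Real.log (cellDensity o t m c)]
  exact ENNReal.ofReal_le_ofReal (sum_cellDensity_mul_log_le ht hm hm1 ht1 hadm)

/-- A point of the cell `c ≠ o` is redistributed over its cell, a point of the cell `o` over the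
whole space. -/
noncomputable def cellKernel (μ : Measure S) (q : S → J) (o c : J) : Measure S :=
  if c = o then μ else ProbabilityTheory.cond μ (q ⁻¹' {c})

/-- The average of the redistributed points. -/
noncomputable def resampledMeasure (μ : Measure S) (q : S → J) (o : J) (n : ℕ) (a : ℕ → J) :
    Measure S :=
  (n : ℝ≥0∞)⁻¹ • ∑ i ∈ Finset.range n, cellKernel μ q o (a i)

omit [Fintype J] in
lemma cellKernel_eq_withDensity {μ : Measure S} [IsFiniteMeasure μ]
    (hq : ∀ c, MeasurableSet (q ⁻¹' {c})) {o c : J} (hc : c ≠ o → μ.real (q ⁻¹' {c}) ≠ 0) :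
    cellKernel μ q o c = μ.withDensity fun x => ENNReal.ofReal
      (if c = o then 1 else if q x = c then (μ.real (q ⁻¹' {c}))⁻¹ else 0) := by
  unfold cellKernel
  by_cases h : c = o
  · simp [h]
  · have hpos : 0 < μ.real (q ⁻¹' {c}) := lt_of_le_of_ne measureReal_nonneg (hc h).symm
    simp only [h, if_false]
    rw [ProbabilityTheory.cond, ← withDensity_indicator_one (hq c),
      ← withDensity_smul _ (measurable_one.indicator (hq c))]
    congr 1
    ext x
    by_cases hx : q x = c
    · simp [hx, ENNReal.ofReal_inv_of_pos hpos]
    · simp [hx]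

/-- Links the two faces of the resampled measure: as an average over the sample it couples with the
empirical measure point by point, as a density its entropy is computable. -/
lemma resampledMeasure_eq_withDensity {μ : Measure S} [IsFiniteMeasure μ]
    (hq : ∀ c, MeasurableSet (q ⁻¹' {c})) {o : J} {n : ℕ} (hn : n ≠ 0) {a : ℕ → J}
    (hadm : ∀ c, c ≠ o → μ.real (q ⁻¹' {c}) = 0 → occupation n a c = 0) :
    resampledMeasure μ q o n a = μ.withDensity fun x => ENNReal.ofReal
      (cellDensity o (fun c => occupation n a c / n) (fun c => μ.real (q ⁻¹' {c})) (q x)) := by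
  have hn' : (0 : ℝ) < n := by positivity
  set h : J → J → ℝ := fun c b => if c = o then 1 else if b = c then (μ.real (q ⁻¹' {c}))⁻¹ else 0
  have hh0 : ∀ c b, 0 ≤ h c b := by
    intro c b
    simp only [h]
    split_ifs <;> positivity
  have hpt : ∀ b, cellDensity o (fun c => occupation n a c / n)
      (fun c => μ.real (q ⁻¹' {c})) b = (n : ℝ)⁻¹ * ∑ i ∈ Finset.range n, h (a i) b := by
    intro b
    rw [sum_range_eq_sum_occupation n a fun c => h c b,
      ← Finset.add_sum_erase _ _ (Finset.mem_univ o)]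
    have e : ∑ c ∈ Finset.univ.erase o, occupation n a c * h c b =
        if b = o then 0 else occupation n a b * (μ.real (q ⁻¹' {b}))⁻¹ := by
      have : ∀ c ∈ Finset.univ.erase o, occupation n a c * h c b =
          if b = c then occupation n a c * (μ.real (q ⁻¹' {c}))⁻¹ else 0 := by
        intro c hc
        simp only [h, (Finset.mem_erase.1 hc).1, if_false, mul_ite, mul_zero]
      rw [Finset.sum_congr rfl this, Finset.sum_ite_eq]
      by_cases hb : b = o <;> simp [hb]
    rw [e]
    unfold cellDensity
    simp only [h, if_true]
    split_ifs
    · field_simp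
      ring
    · field_simp
  have hker : ∀ i ∈ Finset.range n, cellKernel μ q o (a i) =
      μ.withDensity fun x => ENNReal.ofReal (h (a i) (q x)) := by
    intro i hi
    refine cellKernel_eq_withDensity hq fun ho h0 => ?_
    exact (occupation_pos_of_lt (Finset.mem_range.1 hi) a).ne' (hadm _ ho h0)
  ext s hs
  rw [resampledMeasure, Finset.sum_congr rfl hker, Measure.smul_apply, Measure.finsetSum_apply,
    withDensity_apply _ hs, smul_eq_mul]
  have : ∀ x, ENNReal.ofReal (cellDensity o (fun c => occupation n a c / n)
      (fun c => μ.real (q ⁻¹' {c})) (q x)) =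
      (n : ℝ≥0∞)⁻¹ * ∑ i ∈ Finset.range n, ENNReal.ofReal (h (a i) (q x)) := by
    intro x
    rw [hpt, ENNReal.ofReal_mul (by positivity), ENNReal.ofReal_inv_of_pos hn',
      ENNReal.ofReal_natCast, ENNReal.ofReal_sum_of_nonneg fun i _ => hh0 _ _]
  have hmeas : ∀ i, Measurable fun x => ENNReal.ofReal (h (a i) (q x)) := fun i =>
    (measurable_comp_of_fibers hq (h (a i))).ennreal_ofReal
  simp_rw [this]
  rw [lintegral_const_mul _ (Finset.measurable_sum _ fun i _ => hmeas i),
    lintegral_finsetSum _ fun i _ => hmeas i]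
  congr 1
  exact Finset.sum_congr rfl fun i _ => withDensity_apply _ hs

end Cells

/-! ### Probability of a given type. -/

section Types

variable {Ω S J : Type*} [MeasurableSpace Ω] [MeasurableSpace S] [Fintype J] [DecidableEq J]
  {P : Measure Ω} {X : ℕ → Ω → S} {n : ℕ} {q : S → J}

/-- The probability of a type decays at the rate of the inner log-likelihood. -/
lemma measure_occupation_eq_le [IsProbabilityMeasure P] (hX : ∀ i, Measurable (X i))
    (hind : iIndepFun X P) (hn : n ≠ 0) (hq : ∀ c, MeasurableSet (q ⁻¹' {c})) (o : J)
    (k : J → ℕ) (hk : ∑ c, (k c / n : ℝ) = 1)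
    (hadm : ∀ c, c ≠ o → (averagedLaw P n X).real (q ⁻¹' {c}) = 0 → k c = 0) :
    P {ω | ∀ c, occupation n (fun i => q (X i ω)) c = k c} ≤
      ENNReal.ofReal (Real.exp (-(n * ((∑ c, (if c = o then 0 else (k c / n : ℝ) *
        Real.log (cellDensity o (fun c => (k c / n : ℝ))
          (fun c => (averagedLaw P n X).real (q ⁻¹' {c})) c))) -
        (averagedLaw P n X).real (q ⁻¹' {o}))))) := by
  have hμ := isProbabilityMeasure_averagedLaw (P := P) hX hn
  set μ := averagedLaw P n X
  set m : J → ℝ := fun c => μ.real (q ⁻¹' {c}) with hmdef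
  set t : J → ℝ := fun c => k c / n with htdef
  have hn' : (0 : ℝ) < n := by positivity
  have hm : ∀ c, 0 ≤ m c := fun c => measureReal_nonneg
  have ht : ∀ c, 0 ≤ t c := fun c => by positivity
  have hm1 : ∑ c, m c = 1 := sum_measureReal_cells hq
  have hadm' : ∀ c, c ≠ o → m c = 0 → t c = 0 := fun c ho h0 => by
    simp [htdef, hadm c ho h0]
  have hF : ∀ c, 0 ≤ cellDensity o t m c := fun c => cellDensity_nonneg ht hm c
  -- The outer cell gets weight `1` instead of its density `t o`, so that outer points contribute
  -- nothing to the likelihood. The price is a total mass of at most `1 + m o`.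
  set G : J → ℝ := fun c => if c = o then 1 else cellDensity o t m c with hG
  have hG0 : ∀ c, 0 ≤ G c := by
    intro c; simp only [hG]; split_ifs
    · exact zero_le_one
    · exact hF c
  refine measure_le_exp_of_chernoff hX hind hn
    (g := fun x => ENNReal.ofReal (G (q x))) (measurable_comp_of_fibers hq G).ennreal_ofReal
    ?_ ?_ (hm o)
  · intro ω hω
    rw [← ENNReal.ofReal_prod_of_nonneg fun i _ => hG0 _,
      prod_range_eq_prod_occupation n (fun i => q (X i ω)) G, Finset.mul_sum, Real.exp_sum]
    refine ENNReal.ofReal_le_ofReal (Finset.prod_congr rfl fun c _ => ?_).le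
    rw [hω c]
    simp only [hG]
    split_ifs with h
    · simp
    · by_cases hk0 : k c = 0
      · simp [htdef, hk0]
      · have hmc : 0 < m c := lt_of_le_of_ne (hm c) fun h0 => hk0 (hadm c h h0.symm)
        have hkc : (0 : ℝ) < k c := by exact_mod_cast Nat.pos_of_ne_zero hk0
        have hpos : 0 < cellDensity o t m c := by
          unfold cellDensity
          rw [if_neg h]
          have := ht o
          have : 0 < t c / m c := by positivity
          linarith
        have e : (n : ℝ) * (t c * Real.log (cellDensity o t m c)) =
            k c * Real.log (cellDensity o t m c) := by
          simp only [htdef]; field_simp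
        rw [e, Real.exp_nat_mul, Real.exp_log hpos]
  · change ∫⁻ x, ENNReal.ofReal (G (q x)) ∂μ ≤ _
    rw [← ofReal_integral_eq_lintegral_ofReal (integrable_comp_cells hq G)
      (ae_of_all _ fun x => hG0 _), integral_comp_cells hq G]
    refine ENNReal.ofReal_le_ofReal ?_
    rw [← sum_mul_cellDensity_eq_one hm1 hk hadm']
    have : m o = ∑ c, if c = o then m c else 0 := by simp
    change ∑ c, m c * G c ≤ ∑ c, m c * cellDensity o t m c + m o
    rw [this, ← Finset.sum_add_distrib]
    refine Finset.sum_le_sum fun c _ => ?_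
    simp only [hG]
    split_ifs
    · have := mul_nonneg (hm c) (hF c)
      linarith
    · simp

-- A cell null for the average is null for each law, so almost surely no point falls in it. This
-- disposes of the inadmissible types.
omit [Fintype J] in
lemma measure_occupation_eq_zero (hX : ∀ i, Measurable (X i))
    (hq : ∀ c, MeasurableSet (q ⁻¹' {c})) {c : J}
    (h0 : averagedLaw P n X (q ⁻¹' {c}) = 0) {k : J → ℕ} (hk : k c ≠ 0) :
    P {ω | ∀ c, occupation n (fun i => q (X i ω)) c = k c} = 0 := by
  rw [averagedLaw_apply hX (hq c)] at h0
  have h1 : ∑ i ∈ Finset.range n, P (X i ⁻¹' (q ⁻¹' {c})) = 0 := by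
    rcases mul_eq_zero.1 h0 with h | h
    · simp at h
    · exact h
  have h2 : P (⋃ i ∈ Finset.range n, X i ⁻¹' (q ⁻¹' {c})) = 0 :=
    le_antisymm ((measure_biUnion_finset_le _ _).trans h1.le) bot_le
  refine measure_mono_null (fun ω hω => ?_) h2
  have := hω c
  obtain ⟨i, hi, hic⟩ := exists_of_occupation_pos (n := n) (a := fun i => q (X i ω)) (c := c)
    (by rw [this]; exact Nat.pos_of_ne_zero hk)
  simp only [Set.mem_iUnion, Finset.mem_range]
  exact ⟨i, hi, hic⟩

end Types

/-! ### Distance from the empirical measure to the resampled one. -/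

section Resampling

variable {S J : Type*} [NormedAddCommGroup S] [MeasurableSpace S] [BorelSpace S]
  [SecondCountableTopology S] [DecidableEq J] {q : S → J}

/-- The coupling of the empirical measure with the resampled measure. -/
noncomputable def resamplingCoupling (μ : Measure S) (q : S → J) (o : J) (n : ℕ) (x : ℕ → S) :
    Measure (S × S) :=
  (n : ℝ≥0∞)⁻¹ • ∑ i ∈ Finset.range n, (Measure.dirac (x i)).prod (cellKernel μ q o (q (x i)))

omit [NormedAddCommGroup S] [BorelSpace S] [SecondCountableTopology S] in
lemma isProbabilityMeasure_cellKernel {μ : Measure S} [IsProbabilityMeasure μ] {o c : J}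
    (hc : c ≠ o → μ (q ⁻¹' {c}) ≠ 0) : IsProbabilityMeasure (cellKernel μ q o c) := by
  unfold cellKernel
  split_ifs with h
  · infer_instance
  · exact cond_isProbabilityMeasure (hc h)

lemma isCoupling_resamplingCoupling {μ : Measure S} [IsProbabilityMeasure μ] {o : J} {n : ℕ}
    {x : ℕ → S} (hx : ∀ i < n, q (x i) ≠ o → μ (q ⁻¹' {q (x i)}) ≠ 0) :
    IsCoupling (resamplingCoupling μ q o n x) (empiricalMeasure n x)
      (resampledMeasure μ q o n fun i => q (x i)) := by
  constructor
  · ext s hs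
    rw [Measure.map_apply measurable_fst hs, resamplingCoupling, empiricalMeasure,
      Measure.smul_apply, Measure.smul_apply, Measure.finsetSum_apply, Measure.finsetSum_apply]
    congr 1
    refine Finset.sum_congr rfl fun i hi => ?_
    have := isProbabilityMeasure_cellKernel (hx i (Finset.mem_range.1 hi))
    rw [← Measure.map_apply measurable_fst hs, Measure.map_fst_prod]
    simp
  · ext s hs
    rw [Measure.map_apply measurable_snd hs, resamplingCoupling, resampledMeasure,
      Measure.smul_apply, Measure.smul_apply, Measure.finsetSum_apply, Measure.finsetSum_apply]
    congr 1
    refine Finset.sum_congr rfl fun i hi => ?_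
    have := isProbabilityMeasure_cellKernel (hx i (Finset.mem_range.1 hi))
    rw [← Measure.map_apply measurable_snd hs, Measure.map_snd_prod]
    simp

omit [BorelSpace S] in
lemma lintegral_resamplingCoupling {μ : Measure S} [IsProbabilityMeasure μ] {o : J} {n : ℕ}
    {x : ℕ → S} (hx : ∀ i < n, q (x i) ≠ o → μ (q ⁻¹' {q (x i)}) ≠ 0) {f : S × S → ℝ≥0∞}
    (hf : Measurable f) :
    ∫⁻ z, f z ∂(resamplingCoupling μ q o n x) = (n : ℝ≥0∞)⁻¹ *
      ∑ i ∈ Finset.range n, ∫⁻ y, f (x i, y) ∂(cellKernel μ q o (q (x i))) := by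
  rw [resamplingCoupling, lintegral_smul_measure, lintegral_finsetSum_measure, smul_eq_mul]
  congr 1
  refine Finset.sum_congr rfl fun i hi => ?_
  have := isProbabilityMeasure_cellKernel (hx i (Finset.mem_range.1 hi))
  rw [lintegral_prod _ hf.aemeasurable, lintegral_dirac' _ hf.lintegral_prod_right']

/-- The empirical measure is close to the resampled measure when the cells `c ≠ o` are small and
the cell `o` carries little of the `p`-th moment. -/
lemma wassersteinDist_resampledMeasure_le {p : ℝ} (hp : 1 ≤ p) {μ : Measure S}
    [IsProbabilityMeasure μ] (hq : ∀ c, MeasurableSet (q ⁻¹' {c})) {o : J} {δ : ℝ≥0∞}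
    (hδ : ∀ x y, q x = q y → q x ≠ o → edist x y ≤ δ) {n : ℕ} (hn : n ≠ 0)
    {x : ℕ → S} (hx : ∀ i < n, q (x i) ≠ o → μ (q ⁻¹' {q (x i)}) ≠ 0) :
    wassersteinDist p (empiricalMeasure n x) (resampledMeasure μ q o n fun i => q (x i)) ≤
      δ + (((n : ℝ≥0∞)⁻¹ * ∑ i ∈ Finset.range n, (if q (x i) = o then ‖x i‖ₑ ^ p else 0)) ^ (1 / p) +
        ((n : ℝ≥0∞)⁻¹ * (∑ i ∈ Finset.range n, (if q (x i) = o then 1 else 0)) *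
          ∫⁻ y, ‖y‖ₑ ^ p ∂μ) ^ (1 / p)) := by
  have hp0 : 0 < p := by linarith
  set π := resamplingCoupling μ q o n x
  have hπ := isCoupling_resamplingCoupling hx
  have hn1 : (n : ℝ≥0∞)⁻¹ * n = 1 :=
    ENNReal.inv_mul_cancel (by exact_mod_cast hn) (ENNReal.natCast_ne_top n)
  -- The displacement is dominated by `f₁ + f₂ + f₃`: an inner point moves by at most `δ`, an outer
  -- point `x` sent to `y` by at most `‖x‖ + ‖y‖`. Minkowski then separates the three terms.
  let f₁ : S × S → ℝ≥0∞ := fun _ => δ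
  let f₂ : S × S → ℝ≥0∞ := fun z => (q ⁻¹' {o}).indicator (fun x => ‖x‖ₑ) z.1
  let f₃ : S × S → ℝ≥0∞ := fun z => (q ⁻¹' {o}).indicator 1 z.1 * ‖z.2‖ₑ
  have hf₂ : Measurable f₂ := (measurable_enorm.indicator (hq o)).comp measurable_fst
  have hf₃ : Measurable f₃ :=
    ((measurable_one.indicator (hq o)).comp measurable_fst).mul (by fun_prop)
  have hkey : ∫⁻ z, edist z.1 z.2 ^ p ∂π ≤ ∫⁻ z, ((f₁ + (f₂ + f₃)) z) ^ p ∂π := by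
    rw [lintegral_resamplingCoupling hx (by fun_prop),
      lintegral_resamplingCoupling hx
        (Measurable.pow_const (measurable_const.add (hf₂.add hf₃)) p)]
    gcongr (n : ℝ≥0∞)⁻¹ * ?_
    refine Finset.sum_le_sum fun i hi => ?_
    by_cases h : q (x i) = o
    · refine lintegral_mono fun y => ?_
      gcongr
      simp only [Pi.add_apply, f₂, f₃]
      rw [Set.indicator_of_mem (by exact h), Set.indicator_of_mem (by exact h)]
      simp only [Pi.one_apply, one_mul]
      refine le_add_left ?_
      rw [← edist_zero_right, ← edist_zero_right, edist_comm y]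
      exact edist_triangle _ _ _
    · refine lintegral_mono_ae ?_
      unfold cellKernel
      rw [if_neg h]
      filter_upwards [ae_cond_mem (hq _)] with y hy
      gcongr
      simp only [Pi.add_apply]
      exact le_add_right (hδ _ _ (by exact hy.symm) h)
  refine (wassersteinDist_le_of_isCoupling hp hπ).trans ?_
  refine (ENNReal.rpow_le_rpow hkey (by positivity)).trans ?_
  refine (ENNReal.lintegral_Lp_add_le measurable_const.aemeasurable
    (hf₂.add hf₃).aemeasurable hp).trans ?_
  gcongr
  · rw [lintegral_resamplingCoupling hx (by fun_prop)]
    have : ∀ i ∈ Finset.range n,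
        ∫⁻ y, f₁ (x i, y) ^ p ∂(cellKernel μ q o (q (x i))) = δ ^ p := by
      intro i hi
      have := isProbabilityMeasure_cellKernel (hx i (Finset.mem_range.1 hi))
      simp [f₁]
    rw [Finset.sum_congr rfl this, Finset.sum_const, Finset.card_range, nsmul_eq_mul, ← mul_assoc,
      hn1, one_mul, one_div, ENNReal.rpow_rpow_inv hp0.ne']
  refine (ENNReal.lintegral_Lp_add_le hf₂.aemeasurable hf₃.aemeasurable hp).trans ?_
  gcongr
  · rw [lintegral_resamplingCoupling hx (by fun_prop)]
    gcongr with i hi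
    have := isProbabilityMeasure_cellKernel (hx i (Finset.mem_range.1 hi))
    by_cases h : q (x i) = o
    · simp [f₂, h, cellKernel]
    · simp [f₂, h, hp0]
  · rw [lintegral_resamplingCoupling hx (by fun_prop), mul_assoc, Finset.sum_mul]
    gcongr with i hi
    by_cases h : q (x i) = o <;> simp [f₃, h, hp0, cellKernel]

end Resampling

/-! ### Deviation bound for fixed sample size, cells and radius. -/

section FixedSampleSize

variable {Ω S J : Type*} [MeasurableSpace Ω] [NormedAddCommGroup S] [MeasurableSpace S]
  [BorelSpace S] [SecondCountableTopology S] {P : Measure Ω} {X : ℕ → Ω → S} {n : ℕ}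

/-- The contribution of the points of norm `> R` to the `p`-th moment of the empirical measure. -/
noncomputable def outerMoment (p R : ℝ) (n : ℕ) (x : ℕ → S) : ℝ≥0∞ :=
  (n : ℝ≥0∞)⁻¹ * ∑ i ∈ Finset.range n, (if R < ‖x i‖ then ‖x i‖ₑ ^ p else 0)

-- Markov's inequality for the fraction of outer points. It bounds the cost of their new positions
-- by `M / R` times the allowance `η`.
omit [MeasurableSpace S] [BorelSpace S] [SecondCountableTopology S] in
lemma fraction_mul_le_outerMoment {p R : ℝ} (hp : 1 ≤ p) (n : ℕ) (x : ℕ → S) :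
    (n : ℝ≥0∞)⁻¹ * (∑ i ∈ Finset.range n, (if R < ‖x i‖ then 1 else 0)) * ENNReal.ofReal R ^ p ≤
      outerMoment p R n x := by
  rw [outerMoment, mul_assoc, Finset.sum_mul]
  gcongr with i hi
  split_ifs with h
  · rw [one_mul]
    have : ENNReal.ofReal R ≤ ‖x i‖ₑ := by
      rw [← ofReal_norm]
      exact ENNReal.ofReal_le_ofReal h.le
    gcongr
  · simp

variable [CompleteSpace S] [Fintype J] [DecidableEq J] {q : S → J}

/-- The deterministic half of the argument: triangle inequality through the resampled measure, with
the resampling cost on one side and Talagrand's inequality on the other. -/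
lemma wassersteinDist_empiricalMeasure_le {p : ℝ} (hp : 1 ≤ p) {μ : Measure S}
    [IsProbabilityMeasure μ] {lam : ℝ} (hlam : 0 < lam) (hT : SatisfiesTalagrand p lam μ)
    (hq : ∀ c, MeasurableSet (q ⁻¹' {c})) {o : J} {R : ℝ} (hR : 0 < R)
    (ho : ∀ x, q x = o ↔ R < ‖x‖) {δ : ℝ} (hδ0 : 0 ≤ δ)
    (hδ : ∀ x y, q x = q y → q x ≠ o → dist x y ≤ δ) {M : ℝ} (hM0 : 0 ≤ M)
    (hM : ∫⁻ y, ‖y‖ₑ ^ p ∂μ ≤ ENNReal.ofReal M ^ p) {η : ℝ} (hη : 0 ≤ η) {h : ℝ}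
    (hn : n ≠ 0) {x : ℕ → S}
    (hadm : ∀ c, c ≠ o → μ.real (q ⁻¹' {c}) = 0 → occupation n (fun i => q (x i)) c = 0)
    (hout : outerMoment p R n x ≤ ENNReal.ofReal η ^ p)
    (hI : ∑ c, (if c = o then 0 else (occupation n (fun i => q (x i)) c / n : ℝ) *
        Real.log (cellDensity o (fun c => (occupation n (fun i => q (x i)) c / n : ℝ))
          (fun c => μ.real (q ⁻¹' {c})) c)) ≤ h) :
    wassersteinDist p (empiricalMeasure n x) μ ≤
      ENNReal.ofReal (δ + (1 + M / R) * η + Real.sqrt (2 / lam * h)) := by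
  have hp0 : 0 < p := by linarith
  have hx : ∀ i < n, q (x i) ≠ o → μ (q ⁻¹' {q (x i)}) ≠ 0 := fun i hi hio h0 =>
    (occupation_pos_of_lt hi (fun i => q (x i))).ne' (hadm _ hio (by simp [measureReal_def, h0]))
  have hn' : (n : ℝ) ≠ 0 := by exact_mod_cast hn
  have hadm' : ∀ c, c ≠ o → μ.real (q ⁻¹' {c}) = 0 →
      (occupation n (fun i => q (x i)) c / n : ℝ) = 0 := fun c hc h0 => by
    simp [hadm c hc h0]
  obtain ⟨hprob, hkl⟩ := klDiv_cellDensity_le hq (o := o)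
    (t := fun c => (occupation n (fun i => q (x i)) c / n : ℝ)) (fun c => by positivity)
    (by rw [← Finset.sum_div, sum_occupation, div_self hn']) hadm'
  have hres := resampledMeasure_eq_withDensity hq hn hadm
  rw [← hres] at hprob hkl
  refine (wassersteinDist_triangle hp _ (resampledMeasure μ q o n fun i => q (x i)) _).trans ?_
  rw [ENNReal.ofReal_add (by positivity) (by positivity)]
  gcongr
  · refine (wassersteinDist_resampledMeasure_le hp hq (δ := ENNReal.ofReal δ)
      (fun x y hxy hx => ?_) hn hx).trans ?_
    · rw [edist_dist]
      exact ENNReal.ofReal_le_ofReal (hδ x y hxy hx)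
    · simp only [ho]
      rw [ENNReal.ofReal_add hδ0 (by positivity), add_mul, one_mul,
        ENNReal.ofReal_add hη (by positivity)]
      gcongr
      · rw [one_div]
        exact (ENNReal.rpow_inv_le_iff hp0).2 hout
      · rw [one_div, ENNReal.rpow_inv_le_iff hp0, mul_comm (M / R) η, ENNReal.ofReal_mul hη,
          ENNReal.mul_rpow_of_nonneg _ _ hp0.le]
        calc _ ≤ (n : ℝ≥0∞)⁻¹ * (∑ i ∈ Finset.range n, (if R < ‖x i‖ then 1 else 0)) *
              ENNReal.ofReal (R * (M / R)) ^ p := by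
              rw [mul_div_cancel₀ _ hR.ne']
              gcongr
          _ = (n : ℝ≥0∞)⁻¹ * (∑ i ∈ Finset.range n, (if R < ‖x i‖ then 1 else 0)) *
              ENNReal.ofReal R ^ p * ENNReal.ofReal (M / R) ^ p := by
              rw [ENNReal.ofReal_mul hR.le, ENNReal.mul_rpow_of_nonneg _ _ hp0.le, ← mul_assoc]
          _ ≤ _ := by
              gcongr
              exact (fraction_mul_le_outerMoment hp n x).trans hout
  · refine (hT _ hprob).trans ?_
    calc _ ≤ (ENNReal.ofReal (2 / lam) * ENNReal.ofReal h) ^ (1 / 2 : ℝ) := by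
          gcongr
          exact hkl.trans (ENNReal.ofReal_le_ofReal hI)
      _ = ENNReal.ofReal (2 / lam * h) ^ (1 / 2 : ℝ) := by
          rw [ENNReal.ofReal_mul (by positivity)]
      _ ≤ _ := by
          rcases le_or_gt 0 (2 / lam * h) with h0 | h0
          · rw [ENNReal.ofReal_rpow_of_nonneg h0 (by norm_num), Real.sqrt_eq_rpow]
          · rw [ENNReal.ofReal_of_nonpos h0.le]
            simp

/-- Union bound over the types. When the outer moment is small, a deviation beyond `ε` is possible
only for types with inner log-likelihood at least `h`. Monotonicity and subadditivity of the outer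
measure suffice, so measurability of the distance is never needed. -/
lemma measure_lt_wassersteinDist_le [IsProbabilityMeasure P] {p : ℝ} (hp : 1 ≤ p)
    (hX : ∀ i, Measurable (X i)) (hind : iIndepFun X P) (hn : n ≠ 0)
    {lam : ℝ} (hlam : 0 < lam) (hT : SatisfiesTalagrand p lam (averagedLaw P n X))
    (hq : ∀ c, MeasurableSet (q ⁻¹' {c})) {o : J} {R : ℝ} (hR : 0 < R)
    (ho : ∀ x, q x = o ↔ R < ‖x‖) {δ : ℝ} (hδ0 : 0 ≤ δ)
    (hδ : ∀ x y, q x = q y → q x ≠ o → dist x y ≤ δ) {M : ℝ} (hM0 : 0 ≤ M)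
    (hM : ∫⁻ y, ‖y‖ₑ ^ p ∂(averagedLaw P n X) ≤ ENNReal.ofReal M ^ p) {η : ℝ} (hη : 0 ≤ η)
    {h ε : ℝ} (hε : δ + (1 + M / R) * η + Real.sqrt (2 / lam * h) ≤ ε) :
    P {ω | ENNReal.ofReal ε <
        wassersteinDist p (empiricalMeasure n (fun i => X i ω)) (averagedLaw P n X)} ≤
      P {ω | ENNReal.ofReal η ^ p < outerMoment p R n fun i => X i ω} +
      ENNReal.ofReal (((n : ℝ) + 1) ^ Fintype.card J *
        Real.exp (-(n * (h - (averagedLaw P n X).real (q ⁻¹' {o}))))) := by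
  have hμ := isProbabilityMeasure_averagedLaw (P := P) hX hn
  set μ := averagedLaw P n X with hμdef
  set A := {ω | ENNReal.ofReal η ^ p < outerMoment p R n fun i => X i ω}
  let B : (J → Fin (n + 1)) → Set Ω := fun k =>
    {ω | (∀ c, occupation n (fun i => q (X i ω)) c = (k c : ℕ)) ∧
      outerMoment p R n (fun i => X i ω) ≤ ENNReal.ofReal η ^ p ∧
      ENNReal.ofReal ε < wassersteinDist p (empiricalMeasure n (fun i => X i ω)) μ}
  have hsub : {ω | ENNReal.ofReal ε <
      wassersteinDist p (empiricalMeasure n (fun i => X i ω)) μ} ⊆ A ∪ ⋃ k, B k := by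
    intro ω hω
    by_cases hA : ω ∈ A
    · exact Or.inl hA
    · refine Or.inr (Set.mem_iUnion.2
        ⟨fun c => ⟨_, Nat.lt_succ_of_le (occupation_le n (fun i => q (X i ω)) c)⟩, fun c => rfl,
          not_lt.1 hA, hω⟩)
  have hB : ∀ k, P (B k) ≤ ENNReal.ofReal (Real.exp (-(n * (h - μ.real (q ⁻¹' {o}))))) := by
    intro k
    -- The log-likelihood depends on `k` alone, so one realisation `ω` is enough to bound it below
    -- through the deterministic estimate.
    rcases (B k).eq_empty_or_nonempty with he | ⟨ω, hω1, hω2, hω3⟩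
    · rw [he, measure_empty]; exact bot_le
    have hle : P (B k) ≤ P {ω | ∀ c, occupation n (fun i => q (X i ω)) c = (k c : ℕ)} :=
      measure_mono fun ω hω => hω.1
    refine hle.trans ?_
    by_cases hadm : ∀ c, c ≠ o → μ.real (q ⁻¹' {c}) = 0 → (k c : ℕ) = 0
    · have hsum : ∑ c, ((k c : ℕ) / n : ℝ) = 1 := by
        rw [← Finset.sum_div, div_eq_one_iff_eq (by exact_mod_cast hn),
          ← sum_occupation n (fun i => q (X i ω))]
        simp [hω1]
      refine (measure_occupation_eq_le hX hind hn hq o (fun c => (k c : ℕ)) hsum hadm).trans ?_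
      refine ENNReal.ofReal_le_ofReal (Real.exp_le_exp.2 (neg_le_neg ?_))
      gcongr
      by_contra! hlt
      refine absurd hω3 (not_lt.2 ?_)
      refine (wassersteinDist_empiricalMeasure_le hp hlam hT hq hR ho hδ0 hδ hM0 hM hη hn
        (h := h) ?_ hω2 ?_).trans (ENNReal.ofReal_le_ofReal hε)
      · simpa [hω1] using hadm
      · simp only [hω1]
        exact hlt.le
    · push Not at hadm
      obtain ⟨c, -, hc0, hkc⟩ := hadm
      rw [measure_occupation_eq_zero hX hq (c := c) ((measureReal_eq_zero_iff).1 hc0)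
        (k := fun c => (k c : ℕ)) hkc]
      exact bot_le
  refine (measure_mono hsub).trans ((measure_union_le _ _).trans ?_)
  gcongr
  refine (measure_iUnion_fintype_le P B).trans ?_
  refine (Finset.sum_le_sum fun k _ => hB k).trans ?_
  rw [Finset.sum_const, Finset.card_univ, Fintype.card_fun, Fintype.card_fin, nsmul_eq_mul,
    ENNReal.ofReal_mul (by positivity)]
  gcongr
  rw [← ENNReal.ofReal_natCast]
  simp

omit [SecondCountableTopology S] [CompleteSpace S] in
/-- Deviation bound for the moment carried by the points of large norm. -/
lemma measure_lt_outerMoment_le {p : ℝ} (hp1 : 1 ≤ p) (hp2 : p ≤ 2)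
    (hX : ∀ i, Measurable (X i)) (hind : iIndepFun X P) (hn : n ≠ 0)
    [IsProbabilityMeasure P] {R θ τ η : ℝ} (hR : 0 < R) (hθ : 0 ≤ θ) (hτ : 0 ≤ τ) (hη : 0 ≤ η)
    (hint : ∫⁻ x in {x | R < ‖x‖}, ENNReal.ofReal (Real.exp (θ * ‖x‖ ^ 2)) ∂(averagedLaw P n X) ≤
      ENNReal.ofReal τ) :
    P {ω | ENNReal.ofReal η ^ p < outerMoment p R n fun i => X i ω} ≤
      ENNReal.ofReal (Real.exp (-(n * (θ * η ^ p * R ^ (2 - p) - τ)))) := by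
  have hμ := isProbabilityMeasure_averagedLaw (P := P) hX hn
  set μ := averagedLaw P n X with hμdef
  have hs : MeasurableSet {x : S | R < ‖x‖} := measurableSet_lt measurable_const measurable_norm
  have hn0 : (0 : ℝ) < n := by positivity
  have hexp : ∀ x : S, (if R < ‖x‖ then ENNReal.ofReal (Real.exp (θ * ‖x‖ ^ 2)) else 1) =
      ENNReal.ofReal (Real.exp (if R < ‖x‖ then θ * ‖x‖ ^ 2 else 0)) := by
    intro x; split_ifs <;> simp
  refine measure_le_exp_of_chernoff hX hind hn
    (g := fun x => if R < ‖x‖ then ENNReal.ofReal (Real.exp (θ * ‖x‖ ^ 2)) else 1)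
    (Measurable.ite hs (by fun_prop) measurable_const) ?_ ?_ hτ
  · intro ω hω
    simp only [hexp]
    rw [← ENNReal.ofReal_prod_of_nonneg fun i _ => (Real.exp_pos _).le, ← Real.exp_sum]
    refine ENNReal.ofReal_le_ofReal (Real.exp_le_exp.2 ?_)
    have h1 : ENNReal.ofReal (n * η ^ p) <
        ENNReal.ofReal (∑ i ∈ Finset.range n, if R < ‖X i ω‖ then ‖X i ω‖ ^ p else 0) := by
      have h2 : ENNReal.ofReal η ^ p < outerMoment p R n fun i => X i ω := hω
      have h3 : ∀ i ∈ Finset.range n, (if R < ‖X i ω‖ then ‖X i ω‖ₑ ^ p else 0) =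
          ENNReal.ofReal (if R < ‖X i ω‖ then ‖X i ω‖ ^ p else 0) := by
        intro i _
        split_ifs
        · rw [← ofReal_norm, ENNReal.ofReal_rpow_of_nonneg (norm_nonneg _) (by linarith)]
        · simp
      rw [outerMoment, Finset.sum_congr rfl h3, ← ENNReal.ofReal_sum_of_nonneg,
        mul_comm, ← div_eq_mul_inv, ENNReal.lt_div_iff_mul_lt (by simp [hn]) (by simp),
        ENNReal.ofReal_rpow_of_nonneg hη (by linarith), mul_comm] at h2
      · rwa [ENNReal.ofReal_mul hn0.le, ENNReal.ofReal_natCast]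
      · intro i _
        split_ifs <;> positivity
    have h2 := (ENNReal.ofReal_lt_ofReal_iff_of_nonneg (by positivity)).1 h1
    -- Beyond radius `R` one has `‖x‖ ^ 2 ≥ R ^ (2 - p) * ‖x‖ ^ p`: the quadratic exponent gains a
    -- factor `R ^ (2 - p)`, which is trivial at `p = 2`.
    calc (n : ℝ) * (θ * η ^ p * R ^ (2 - p)) = θ * R ^ (2 - p) * (n * η ^ p) := by ring
      _ ≤ θ * R ^ (2 - p) * ∑ i ∈ Finset.range n, (if R < ‖X i ω‖ then ‖X i ω‖ ^ p else 0) := by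
          gcongr
      _ ≤ _ := by
          rw [Finset.mul_sum]
          refine Finset.sum_le_sum fun i _ => ?_
          split_ifs with h
          · have hpos : 0 < ‖X i ω‖ := hR.trans h
            rw [mul_assoc]
            refine mul_le_mul_of_nonneg_left ?_ hθ
            calc R ^ (2 - p) * ‖X i ω‖ ^ p ≤ ‖X i ω‖ ^ (2 - p) * ‖X i ω‖ ^ p := by
                  gcongr
              _ = ‖X i ω‖ ^ 2 := by
                  rw [← Real.rpow_add hpos]
                  norm_num
          · simp
  · calc _ ≤ ∫⁻ x, (1 + {x : S | R < ‖x‖}.indicator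
          (fun x => ENNReal.ofReal (Real.exp (θ * ‖x‖ ^ 2))) x) ∂μ := by
          refine lintegral_mono fun x => ?_
          by_cases h : R < ‖x‖ <;> simp [h]
      _ = 1 + ∫⁻ x in {x | R < ‖x‖}, ENNReal.ofReal (Real.exp (θ * ‖x‖ ^ 2)) ∂μ := by
          rw [lintegral_add_left measurable_const, lintegral_indicator hs]
          simp
      _ ≤ 1 + ENNReal.ofReal τ := by gcongr
      _ = _ := by rw [ENNReal.ofReal_add zero_le_one hτ, ENNReal.ofReal_one]

/-- Deviation bound for a fixed sample size, cell decomposition and truncation radius. -/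
theorem measure_lt_wassersteinDist_le_of_cells [IsProbabilityMeasure P] {p : ℝ} (hp1 : 1 ≤ p)
    (hp2 : p ≤ 2) (hX : ∀ i, Measurable (X i)) (hind : iIndepFun X P) (hn : n ≠ 0)
    {lam : ℝ} (hlam : 0 < lam) (hT : SatisfiesTalagrand p lam (averagedLaw P n X))
    (hq : ∀ c, MeasurableSet (q ⁻¹' {c})) {o : J} {R : ℝ} (hR : 0 < R)
    (ho : ∀ x, q x = o ↔ R < ‖x‖) {δ : ℝ} (hδ0 : 0 ≤ δ)
    (hδ : ∀ x y, q x = q y → q x ≠ o → dist x y ≤ δ) {M : ℝ} (hM0 : 0 ≤ M)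
    (hM : ∫⁻ y, ‖y‖ₑ ^ p ∂(averagedLaw P n X) ≤ ENNReal.ofReal M ^ p) {η : ℝ} (hη : 0 ≤ η)
    {h ε : ℝ} (hε : δ + (1 + M / R) * η + Real.sqrt (2 / lam * h) ≤ ε)
    {θ τ : ℝ} (hθ : 0 ≤ θ) (hτ : 0 ≤ τ)
    (hint : ∫⁻ x in {x | R < ‖x‖}, ENNReal.ofReal (Real.exp (θ * ‖x‖ ^ 2)) ∂(averagedLaw P n X) ≤
      ENNReal.ofReal τ) :
    P {ω | ENNReal.ofReal ε <
        wassersteinDist p (empiricalMeasure n (fun i => X i ω)) (averagedLaw P n X)} ≤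
      ENNReal.ofReal (Real.exp (-(n * (θ * η ^ p * R ^ (2 - p) - τ))) +
        ((n : ℝ) + 1) ^ Fintype.card J * Real.exp (-(n * (h - τ)))) := by
  have hμ := isProbabilityMeasure_averagedLaw (P := P) hX hn
  refine (measure_lt_wassersteinDist_le hp1 hX hind hn hlam hT hq hR ho hδ0 hδ hM0 hM hη hε).trans ?_
  rw [ENNReal.ofReal_add (by positivity) (by positivity)]
  refine add_le_add (measure_lt_outerMoment_le hp1 hp2 hX hind hn hR hθ hτ hη hint) ?_
  refine ENNReal.ofReal_le_ofReal ?_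
  have hset : q ⁻¹' {o} = {x | R < ‖x‖} := by
    ext x; simpa using ho x
  -- The exponential is at least `1`, so the same `τ` also bounds the mass of the exterior.
  have hmo : (averagedLaw P n X).real (q ⁻¹' {o}) ≤ τ := by
    refine ENNReal.toReal_le_of_le_ofReal hτ (le_trans ?_ hint)
    rw [hset, ← setLIntegral_one]
    refine lintegral_mono fun x => ?_
    rw [← ENNReal.ofReal_one]
    exact ENNReal.ofReal_le_ofReal (Real.one_le_exp (by positivity))
  gcongr

end FixedSampleSize

/-! ### Moments, and square-exponential integrability from Talagrand's inequality. -/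

section Moments

variable {S : Type*} [NormedAddCommGroup S] [MeasurableSpace S] [BorelSpace S]

/-- From `‖x‖ ^ p ≤ 1 + ‖x‖ ^ 2` and `α ‖x‖ ^ 2 ≤ exp (α ‖x‖ ^ 2)`. The bound `1 + E / α` is at
least `1`, hence below its own `p`-th power, which avoids a root. -/
lemma lintegral_enorm_rpow_le {p : ℝ} (hp1 : 1 ≤ p) (hp2 : p ≤ 2) {α : ℝ} (hα : 0 < α) {E : ℝ≥0}
    {μ : Measure S} [IsProbabilityMeasure μ]
    (hE : ∫⁻ x, ENNReal.ofReal (Real.exp (α * ‖x‖ ^ 2)) ∂μ ≤ E) :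
    ∫⁻ x, ‖x‖ₑ ^ p ∂μ ≤ ENNReal.ofReal (1 + E / α) ^ p := by
  have hpt : ∀ x : S, ‖x‖ₑ ^ p ≤
      1 + ENNReal.ofReal α⁻¹ * ENNReal.ofReal (Real.exp (α * ‖x‖ ^ 2)) := by
    intro x
    rw [← ofReal_norm, ENNReal.ofReal_rpow_of_nonneg (norm_nonneg _) (by linarith),
      ← ENNReal.ofReal_mul (by positivity), ← ENNReal.ofReal_one,
      ← ENNReal.ofReal_add zero_le_one (by positivity)]
    refine ENNReal.ofReal_le_ofReal ?_
    have h1 : ‖x‖ ^ p ≤ 1 + ‖x‖ ^ 2 := by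
      rcases le_total ‖x‖ 1 with h | h
      · have := Real.rpow_le_one (norm_nonneg x) h (by linarith : 0 ≤ p)
        nlinarith [sq_nonneg ‖x‖]
      · have := Real.rpow_le_rpow_of_exponent_le h hp2
        rw [Real.rpow_two] at this
        linarith
    have h2 : ‖x‖ ^ 2 ≤ α⁻¹ * Real.exp (α * ‖x‖ ^ 2) := by
      rw [← div_eq_inv_mul, le_div_iff₀ hα]
      linarith [Real.add_one_le_exp (α * ‖x‖ ^ 2)]
    linarith
  have hM : (1 : ℝ) ≤ 1 + E / α := by
    have : 0 ≤ (E : ℝ) / α := by positivity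
    linarith
  calc ∫⁻ x, ‖x‖ₑ ^ p ∂μ ≤ ∫⁻ x, (1 + ENNReal.ofReal α⁻¹ *
        ENNReal.ofReal (Real.exp (α * ‖x‖ ^ 2))) ∂μ := lintegral_mono hpt
    _ = 1 + ENNReal.ofReal α⁻¹ * ∫⁻ x, ENNReal.ofReal (Real.exp (α * ‖x‖ ^ 2)) ∂μ := by
        rw [lintegral_add_left measurable_const, lintegral_const_mul _ (by fun_prop)]
        simp
    _ ≤ 1 + ENNReal.ofReal α⁻¹ * E := by gcongr
    _ = ENNReal.ofReal (1 + E / α) := by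
        rw [ENNReal.ofReal_add zero_le_one (by positivity), ENNReal.ofReal_one, div_eq_inv_mul,
          ENNReal.ofReal_mul (by positivity), ENNReal.ofReal_coe_nnreal]
    _ ≤ ENNReal.ofReal ((1 + E / α) ^ p) :=
        ENNReal.ofReal_le_ofReal (Real.self_le_rpow_of_one_le hM hp1)
    _ = _ := (ENNReal.ofReal_rpow_of_nonneg (by linarith) (by linarith)).symm

lemma lintegral_averagedLaw_exp_le {Ω : Type*} [MeasurableSpace Ω] {P : Measure Ω}
    {X : ℕ → Ω → S} (hX : ∀ i, Measurable (X i)) {n : ℕ} (hn : n ≠ 0) {α : ℝ} {E : ℝ≥0∞}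
    (hE : sqExpMoment P α X ≤ E) :
    ∫⁻ x, ENNReal.ofReal (Real.exp (α * ‖x‖ ^ 2)) ∂(averagedLaw P n X) ≤ E := by
  rw [lintegral_averagedLaw hX (by fun_prop)]
  calc _ ≤ (n : ℝ≥0∞)⁻¹ * ∑ i ∈ Finset.range n, E := by
        gcongr with i hi
        rw [← lintegral_map (f := fun x : S => ENNReal.ofReal (Real.exp (α * ‖x‖ ^ 2)))
          (by fun_prop) (hX i)]
        exact (le_iSup (fun i => ∫⁻ x, ENNReal.ofReal (Real.exp (α * ‖x‖ ^ 2)) ∂(P.map (X i)))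
          i).trans hE
    _ = E := by
        rw [Finset.sum_const, Finset.card_range, nsmul_eq_mul, ← mul_assoc,
          ENNReal.inv_mul_cancel (by exact_mod_cast hn) (ENNReal.natCast_ne_top n), one_mul]

lemma setLIntegral_exp_le {μ : Measure S} {R θ θ' : ℝ} (hR : 0 ≤ R) (hθ : θ ≤ θ') {B : ℝ}
    (hB : ∫⁻ x, ENNReal.ofReal (Real.exp (θ' * ‖x‖ ^ 2)) ∂μ ≤ ENNReal.ofReal B) :
    ∫⁻ x in {x | R < ‖x‖}, ENNReal.ofReal (Real.exp (θ * ‖x‖ ^ 2)) ∂μ ≤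
      ENNReal.ofReal (Real.exp (-((θ' - θ) * R ^ 2)) * B) := by
  have hs : MeasurableSet {x : S | R < ‖x‖} := measurableSet_lt measurable_const measurable_norm
  rw [ENNReal.ofReal_mul (Real.exp_pos _).le]
  calc _ ≤ ∫⁻ x in {x | R < ‖x‖}, ENNReal.ofReal (Real.exp (-((θ' - θ) * R ^ 2))) *
        ENNReal.ofReal (Real.exp (θ' * ‖x‖ ^ 2)) ∂μ := by
        refine setLIntegral_mono' hs fun x hx => ?_
        rw [← ENNReal.ofReal_mul (Real.exp_pos _).le, ← Real.exp_add]
        refine ENNReal.ofReal_le_ofReal (Real.exp_le_exp.2 ?_)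
        have h1 : R ^ 2 ≤ ‖x‖ ^ 2 := by
          have : R < ‖x‖ := hx
          gcongr
        nlinarith [mul_le_mul_of_nonneg_left h1 (sub_nonneg.2 hθ)]
    _ ≤ ∫⁻ x, ENNReal.ofReal (Real.exp (-((θ' - θ) * R ^ 2))) *
        ENNReal.ofReal (Real.exp (θ' * ‖x‖ ^ 2)) ∂μ := setLIntegral_le_lintegral _ _
    _ ≤ _ := by
        rw [lintegral_const_mul _ (by fun_prop)]
        gcongr

variable [SecondCountableTopology S]

/-- The quadratic Talagrand inequality bounds the truncated square-exponential moments. -/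
lemma integral_exp_min_sq_le {lam : ℝ} {μ : Measure S} [IsProbabilityMeasure μ]
    (hT : SatisfiesTalagrand 2 lam μ) {M : ℝ} (hM0 : 0 ≤ M)
    (hM : ∫⁻ x, ‖x‖ₑ ^ (2 : ℝ) ∂μ ≤ ENNReal.ofReal M ^ (2 : ℝ)) {θ : ℝ} (hθ : 0 < θ)
    (hθlam : θ < lam / 2) (N : ℝ) (hN : 0 ≤ N) :
    ∫ x, Real.exp (θ * min ‖x‖ N ^ 2) ∂μ ≤
      Real.exp (θ * (lam / 2) * M ^ 2 / (lam / 2 - θ)) := by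
  have hlam : 0 < lam := by linarith
  -- Truncation makes the partition function `Z` finite a priori; the final bound does not depend on
  -- `N`.
  set ψ : S → ℝ := fun x => min ‖x‖ N with hψ
  have hψm : Measurable ψ := by fun_prop
  have hψ0 : ∀ x, 0 ≤ ψ x := fun x => le_min (norm_nonneg _) hN
  have hψN : ∀ x, ψ x ≤ N := fun x => min_le_right _ _
  have hψsq : ∀ x, ψ x ^ 2 ≤ N ^ 2 := fun x => pow_le_pow_left₀ (hψ0 x) (hψN x) 2
  have hexpb : ∀ x, Real.exp (θ * ψ x ^ 2) ≤ Real.exp (θ * N ^ 2) := fun x =>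
    Real.exp_le_exp.2 (by have := hψsq x; gcongr)
  have hei : Integrable (fun x => Real.exp (θ * ψ x ^ 2)) μ :=
    integrable_of_bounded (by fun_prop) ⟨Real.exp (θ * N ^ 2), fun x => by
      rw [abs_of_pos (Real.exp_pos _)]; exact hexpb x⟩
  set Z := ∫ x, Real.exp (θ * ψ x ^ 2) ∂μ with hZ
  have hZ1 : 1 ≤ Z := by
    calc (1 : ℝ) = ∫ _, (1 : ℝ) ∂μ := by simp
      _ ≤ Z := integral_mono (integrable_const _) hei fun x =>
          Real.one_le_exp (by positivity)
  have hZ0 : 0 < Z := by linarith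
  -- Talagrand's inequality is tested on the Gibbs measure with this density, whose entropy is
  -- exactly `θ V - log Z`.
  set f : S → ℝ := fun x => Real.exp (θ * ψ x ^ 2) / Z with hf
  have hfm : Measurable f := by fun_prop
  have hf0 : ∀ x, 0 ≤ f x := fun x => by positivity
  have hfi : Integrable f μ := hei.div_const Z
  have hf1 : ∫ x, f x ∂μ = 1 := by
    rw [integral_div, ← hZ, div_self hZ0.ne']
  have hψfi : Integrable (fun x => f x * ψ x ^ 2) μ := by
    refine integrable_of_bounded (by fun_prop) ⟨Real.exp (θ * N ^ 2) / Z * N ^ 2, fun x => ?_⟩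
    rw [abs_of_nonneg (mul_nonneg (hf0 x) (sq_nonneg _))]
    have h1 := hexpb x
    have h2 := hψsq x
    simp only [hf]
    gcongr
  have hlog : ∀ x, f x * Real.log (f x) = θ * (f x * ψ x ^ 2) - Real.log Z * f x := by
    intro x
    have : Real.log (f x) = θ * ψ x ^ 2 - Real.log Z := by
      simp only [hf]
      rw [Real.log_div (Real.exp_pos _).ne' hZ0.ne', Real.log_exp]
    rw [this]; ring
  have hfli : Integrable (fun x => f x * Real.log (f x)) μ := by
    simp only [hlog]
    exact (hψfi.const_mul θ).sub (hfi.const_mul _)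
  set V := ∫ x, f x * ψ x ^ 2 ∂μ with hV
  have hV0 : 0 ≤ V := integral_nonneg fun x => mul_nonneg (hf0 x) (sq_nonneg _)
  have hH : ∫ x, f x * Real.log (f x) ∂μ = θ * V - Real.log Z := by
    simp only [hlog]
    rw [integral_sub (hψfi.const_mul θ) (hfi.const_mul _), integral_const_mul, integral_const_mul,
      hf1, mul_one]
  have hH0 : 0 ≤ θ * V - Real.log Z := by
    rw [← hH]
    calc (0 : ℝ) = ∫ x, (f x - 1) ∂μ := by
          rw [integral_sub hfi (integrable_const _), hf1]; simp
      _ ≤ _ := by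
          refine integral_mono (hfi.sub (integrable_const _)) hfli fun x => ?_
          have := InformationTheory.klFun_nonneg (hf0 x)
          rw [InformationTheory.klFun] at this
          simp only
          linarith
  set H := θ * V - Real.log Z with hHdef
  have hprob := isProbabilityMeasure_withDensity_ofReal hf0 hfi hf1
  have hkl := klDiv_withDensity_ofReal hfm hf0 hfi hf1 hfli
  rw [hH] at hkl
  set ν := μ.withDensity fun x => ENNReal.ofReal (f x) with hν
  have hW : wassersteinDist 2 ν μ ≤ ENNReal.ofReal (Real.sqrt (2 / lam * H)) := by
    refine (hT ν hprob).trans ?_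
    rw [hkl, ← ENNReal.ofReal_mul (by positivity),
      ENNReal.ofReal_rpow_of_nonneg (by positivity) (by norm_num), Real.sqrt_eq_rpow]
  have hVl : ∫⁻ x, ENNReal.ofReal (ψ x) ^ (2 : ℝ) ∂ν = ENNReal.ofReal V := by
    rw [hν, lintegral_withDensity_eq_lintegral_mul _ hfm.ennreal_ofReal (by fun_prop), hV,
      ofReal_integral_eq_lintegral_ofReal hψfi
        (ae_of_all _ fun x => mul_nonneg (hf0 x) (sq_nonneg _))]
    refine lintegral_congr fun x => ?_
    rw [Pi.mul_apply, ENNReal.ofReal_rpow_of_nonneg (hψ0 x) (by norm_num), Real.rpow_two,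
      ENNReal.ofReal_mul (hf0 x)]
  have hkey := lintegral_rpow_le_wassersteinDist_add (p := 2) (by norm_num) ν μ
    (ψ := fun x => ENNReal.ofReal (ψ x)) hψm.ennreal_ofReal fun x => by
      rw [← ofReal_norm]
      exact ENNReal.ofReal_le_ofReal (min_le_left _ _)
  rw [hVl] at hkey
  have hreal : Real.sqrt V ≤ Real.sqrt (2 / lam * H) + M := by
    rw [← ENNReal.ofReal_le_ofReal_iff (by positivity),
      ENNReal.ofReal_add (Real.sqrt_nonneg _) hM0, Real.sqrt_eq_rpow V,
      ← ENNReal.ofReal_rpow_of_nonneg hV0 (by norm_num)]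
    refine hkey.trans ?_
    gcongr
    rw [one_div, ENNReal.rpow_inv_le_iff (by norm_num)]
    exact hM
  -- The right side is the maximum over `u` of `θ u ^ 2 - lam / 2 * (u - M) ^ 2`, finite because `θ
  -- < lam / 2`. For `u ≤ M` Talagrand's inequality gives nothing, but `θ M ^ 2` already suffices.
  have hlogZ : Real.log Z ≤ θ * (lam / 2) * M ^ 2 / (lam / 2 - θ) := by
    rw [le_div_iff₀ (by linarith)]
    set u := Real.sqrt V
    have hu0 : 0 ≤ u := Real.sqrt_nonneg _
    have huV : u ^ 2 = V := Real.sq_sqrt hV0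
    have hlz : Real.log Z = θ * u ^ 2 - H := by rw [huV]; ring
    have hg : 0 < lam / 2 - θ := by linarith
    rcases le_total u M with huM | huM
    · have h1 : Real.log Z ≤ θ * M ^ 2 := by
        rw [hlz]
        have : u ^ 2 ≤ M ^ 2 := by gcongr
        nlinarith
      calc Real.log Z * (lam / 2 - θ) ≤ θ * M ^ 2 * (lam / 2 - θ) := by gcongr
        _ ≤ θ * (lam / 2) * M ^ 2 := by nlinarith [sq_nonneg (θ * M)]
    · have h1 : (u - M) ^ 2 ≤ 2 / lam * H := by
        rw [← Real.sq_sqrt (by positivity : 0 ≤ 2 / lam * H)]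
        exact pow_le_pow_left₀ (by linarith) (by linarith) 2
      have h2 : lam / 2 * (u - M) ^ 2 ≤ H := by
        calc lam / 2 * (u - M) ^ 2 ≤ lam / 2 * (2 / lam * H) := by gcongr
          _ = H := by field_simp
      have h3 : Real.log Z ≤ θ * u ^ 2 - lam / 2 * (u - M) ^ 2 := by linarith
      calc Real.log Z * (lam / 2 - θ)
          ≤ (θ * u ^ 2 - lam / 2 * (u - M) ^ 2) * (lam / 2 - θ) := by gcongr
        _ ≤ _ := by nlinarith [sq_nonneg ((lam / 2 - θ) * u - lam / 2 * M)]
  calc Z = Real.exp (Real.log Z) := (Real.exp_log hZ0).symm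
    _ ≤ _ := Real.exp_le_exp.2 hlogZ

/-- The quadratic Talagrand inequality yields all square-exponential moments of order below
`lam / 2`. -/
lemma lintegral_exp_sq_le {lam : ℝ} {μ : Measure S} [IsProbabilityMeasure μ]
    (hT : SatisfiesTalagrand 2 lam μ) {M : ℝ} (hM0 : 0 ≤ M)
    (hM : ∫⁻ x, ‖x‖ₑ ^ (2 : ℝ) ∂μ ≤ ENNReal.ofReal M ^ (2 : ℝ)) {θ : ℝ} (hθ : 0 < θ)
    (hθlam : θ < lam / 2) :
    ∫⁻ x, ENNReal.ofReal (Real.exp (θ * ‖x‖ ^ 2)) ∂μ ≤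
      ENNReal.ofReal (Real.exp (θ * (lam / 2) * M ^ 2 / (lam / 2 - θ))) := by
  have hlim : Filter.Tendsto
      (fun N : ℕ => ∫⁻ x, ENNReal.ofReal (Real.exp (θ * min ‖x‖ N ^ 2)) ∂μ) Filter.atTop
      (nhds (∫⁻ x, ENNReal.ofReal (Real.exp (θ * ‖x‖ ^ 2)) ∂μ)) := by
    refine lintegral_tendsto_of_tendsto_of_monotone (fun N => by fun_prop) ?_ ?_
    · refine ae_of_all _ fun x N N' h => ?_
      have h1 : (N : ℝ) ≤ N' := by exact_mod_cast h
      refine ENNReal.ofReal_le_ofReal (Real.exp_le_exp.2 ?_)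
      gcongr
    · refine ae_of_all _ fun x => tendsto_const_nhds.congr' ?_
      filter_upwards [Filter.eventually_ge_atTop ⌈‖x‖⌉₊] with N hN
      rw [min_eq_left (Nat.ceil_le.1 hN)]
  refine le_of_tendsto' hlim fun N => ?_
  have hei : Integrable (fun x => Real.exp (θ * min ‖x‖ (N : ℝ) ^ 2)) μ := by
    refine integrable_of_bounded (by fun_prop) ⟨Real.exp (θ * (N : ℝ) ^ 2), fun x => ?_⟩
    rw [abs_of_pos (Real.exp_pos _)]
    have : min ‖x‖ (N : ℝ) ≤ N := min_le_right _ _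
    have : 0 ≤ min ‖x‖ (N : ℝ) := le_min (norm_nonneg _) (by positivity)
    gcongr
  rw [← ofReal_integral_eq_lintegral_ofReal hei (ae_of_all _ fun x => (Real.exp_pos _).le)]
  exact ENNReal.ofReal_le_ofReal (integral_exp_min_sq_le hT hM0 hM hθ hθlam N (by positivity))

end Moments

/-! ### Finite decomposition into a grid and an exterior. -/

section Grid

/-- A decomposition of Euclidean space into finitely many cells: the exterior of a ball, and cells
of small diameter covering the ball. -/
lemma exists_cells (d : ℕ) {R δ : ℝ} (hR : 0 < R) (hδ : 0 < δ) :
    ∃ (J : Type) (_ : Fintype J) (_ : DecidableEq J) (q : EuclideanSpace ℝ (Fin d) → J) (o : J),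
      (∀ c, MeasurableSet (q ⁻¹' {c})) ∧ (∀ x, q x = o ↔ R < ‖x‖) ∧
      (∀ x y, q x = q y → q x ≠ o → dist x y ≤ δ) ∧
      (Fintype.card J : ℝ) ≤ (2 * (d + 1) * (R / δ) + 3) ^ d + 1 := by
  classical
  -- A cube of side `h` has diameter at most `√d * h ≤ δ`; dividing by `d + 1` also covers `d = 0`.
  set h : ℝ := δ / (d + 1) with hh
  have hh0 : 0 < h := by positivity
  set L : ℕ := ⌈R / h⌉₊ with hL
  -- On the ball the floors lie in `[-L, L]`, so the reduction modulo `2 * L + 1` in `Fin.ofNat`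
  -- never wraps there; outside the ball `g` is not used.
  let g : EuclideanSpace ℝ (Fin d) → Fin d → Fin (2 * L + 1) := fun x i =>
    Fin.ofNat (2 * L + 1) (⌊x i / h⌋ + L).toNat
  have hgm : ∀ v, MeasurableSet (g ⁻¹' {v}) := by
    intro v
    have : g ⁻¹' {v} = ⋂ i, {x | Fin.ofNat (2 * L + 1) (⌊x i / h⌋ + L).toNat = v i} := by
      ext x
      simp [g, funext_iff]
    rw [this]
    refine MeasurableSet.iInter fun i => ?_
    have hm : Measurable fun x : EuclideanSpace ℝ (Fin d) => ⌊x i / h⌋ :=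
      Int.measurable_floor.comp (by fun_prop)
    exact hm (MeasurableSet.of_discrete (s := {z : ℤ | Fin.ofNat (2 * L + 1) (z + L).toNat = v i}))
  have hball : MeasurableSet {x : EuclideanSpace ℝ (Fin d) | R < ‖x‖} :=
    measurableSet_lt measurable_const measurable_norm
  have hrange : ∀ x : EuclideanSpace ℝ (Fin d), ‖x‖ ≤ R → ∀ i,
      0 ≤ ⌊x i / h⌋ + L ∧ ⌊x i / h⌋ + L < 2 * L + 1 := by
    intro x hx i
    have h1 : |x i| ≤ R := (by simpa using PiLp.norm_apply_le x i : |x i| ≤ ‖x‖).trans hx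
    have h2 : |x i / h| ≤ L := by
      rw [abs_div, abs_of_pos hh0]
      exact (by gcongr : |x i| / h ≤ R / h).trans (Nat.le_ceil _)
    obtain ⟨h3, h4⟩ := abs_le.1 h2
    constructor
    · have : (-(L : ℤ)) ≤ ⌊x i / h⌋ := Int.le_floor.2 (by push_cast; exact h3)
      linarith
    · have : ⌊x i / h⌋ ≤ (L : ℤ) := by
        have h5 := (Int.floor_le (x i / h)).trans h4
        rw [← Int.cast_natCast] at h5
        exact Int.cast_le.1 h5
      linarith
  refine ⟨Option (Fin d → Fin (2 * L + 1)), inferInstance, inferInstance,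
    fun x => if R < ‖x‖ then none else some (g x), none, ?_, ?_, ?_, ?_⟩
  · rintro (_ | v)
    · convert hball using 1
      ext x; simp
    · convert hball.compl.inter (hgm v) using 1
      ext x; simp
  · intro x; simp
  · intro x y hxy hx
    by_cases hxR : R < ‖x‖
    · simp [hxR] at hx
    by_cases hyR : R < ‖y‖
    · simp [hxR, hyR] at hxy
    simp only [hxR, hyR, if_false, Option.some.injEq] at hxy
    have hcoord : ∀ i, dist (x i) (y i) ≤ h := by
      intro i
      have hi := congrFun hxy i
      obtain ⟨hx1, hx2⟩ := hrange x (not_lt.1 hxR) i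
      obtain ⟨hy1, hy2⟩ := hrange y (not_lt.1 hyR) i
      have hfl : ⌊x i / h⌋ = ⌊y i / h⌋ := by
        have := congrArg Fin.val hi
        simp only [g, Fin.ofNat] at this
        rw [Nat.mod_eq_of_lt (by omega), Nat.mod_eq_of_lt (by omega)] at this
        omega
      have := Int.abs_sub_lt_one_of_floor_eq_floor hfl
      rw [← sub_div, abs_div, abs_of_pos hh0, div_lt_one hh0] at this
      exact this.le
    rw [EuclideanSpace.dist_eq]
    refine Real.sqrt_le_iff.2 ⟨hδ.le, ?_⟩
    calc ∑ i, dist (x i) (y i) ^ 2 ≤ ∑ _i : Fin d, h ^ 2 := by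
          gcongr with i hi
          exact hcoord i
      _ = d * h ^ 2 := by simp
      _ ≤ ((d + 1) * h) ^ 2 := by
          have : (0 : ℝ) ≤ d := by positivity
          nlinarith [sq_nonneg h, mul_nonneg this (sq_nonneg h), mul_nonneg (mul_nonneg this this) (sq_nonneg h)]
      _ = δ ^ 2 := by rw [hh]; field_simp
  · rw [Fintype.card_option, Fintype.card_fun, Fintype.card_fin, Fintype.card_fin]
    push_cast
    have h1 : (L : ℝ) < R / h + 1 := Nat.ceil_lt_add_one (by positivity)
    have h2 : R / h = (d + 1) * (R / δ) := by rw [hh]; field_simp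
    rw [h2] at h1
    have h3 : 2 * (L : ℝ) + 1 ≤ 2 * (d + 1) * (R / δ) + 3 := by linarith
    gcongr

end Grid

/-! ### Choice of constants and absorption of error terms. -/

section Parameters

/-- Choice of the proportions of the deviation allotted to the outer points (`s`) and to the
diameter of the cells (`s'`), of a rate `A` above the claimed one, and of the exponents `θ < θ'`. -/
lemma exists_rate_parameters {p : ℝ} (hp1 : 1 ≤ p) (hp2 : p ≤ 2) {lam : ℝ} (hlam : 0 < lam)
    {α : ℝ} (hα : 0 < α) {lam' : ℝ} (hlam' : lam' < lam) :
    ∃ s s' A θ θ' ρ : ℝ, 0 < s ∧ 0 < s' ∧ 0 < A ∧ gammaConst p * (lam' / 2) < A ∧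
      s + s' + Real.sqrt (2 / lam * A) ≤ 1 ∧ 0 < θ ∧ θ < θ' ∧
      (θ' = α ∨ p = 2 ∧ θ' < lam / 2) ∧
      ∀ x, ρ ≤ x → A ≤ θ * (s / (11 / 10)) ^ p * x ^ (2 - p) := by
  rcases hp2.lt_or_eq with hp | hp
  -- A ratio strictly between `lam' / lam` and `1`; the `1 / 2` keeps it positive when `lam' ≤ 0`.
  -- The slack `1 - √y` is split evenly between `s` and `s'`.
  · set y : ℝ := (1 + max (lam' / lam) (1 / 2)) / 2 with hy
    have hy1 : max (lam' / lam) (1 / 2) < 1 :=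
      max_lt ((div_lt_one hlam).2 hlam') (by norm_num)
    have hylt : y < 1 := by rw [hy]; linarith
    have hy0 : 0 < y := by
      have := le_max_right (lam' / lam) (1 / 2)
      rw [hy]; linarith
    have hygt : lam' / lam < y := by
      have := le_max_left (lam' / lam) (1 / 2)
      rw [hy]; linarith
    have hsq : Real.sqrt y < 1 := by
      rw [Real.sqrt_lt' one_pos]; simpa using hylt
    set s : ℝ := (1 - Real.sqrt y) / 2 with hs
    have hs0 : 0 < s := by rw [hs]; linarith
    have hc : 0 < α / 2 * (s / (11 / 10)) ^ p := by positivity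
    refine ⟨s, s, lam / 2 * y, α / 2, α, (lam / 2 * y / (α / 2 * (s / (11 / 10)) ^ p)) ^ (2 - p)⁻¹,
      hs0, hs0, by positivity, ?_, ?_, by positivity, by linarith, Or.inl rfl, ?_⟩
    · rw [gammaConst, if_pos hp]
      rw [div_lt_iff₀ hlam] at hygt
      linarith
    · have : 2 / lam * (lam / 2 * y) = y := by field_simp
      rw [this, hs]
      linarith
    · intro x hx
      have hq : 0 < 2 - p := by linarith
      have h0 : 0 ≤ lam / 2 * y / (α / 2 * (s / (11 / 10)) ^ p) := by positivity
      have := Real.rpow_le_rpow (by positivity) hx hq.le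
      rw [Real.rpow_inv_rpow h0 hq.ne', div_le_iff₀ hc] at this
      linarith
  · subst hp
    -- At `p = 2` the radius does not help, so `θ * (s / 1.1) ^ 2 ≈ 0.093 * lam` must itself exceed
    -- `A`. The claimed rate at `lam' = lam` is about `0.0858 * lam`, and the proportions add up to
    -- at most `0.975`.
    refine ⟨1 / 2, 1 / 20, 9 / 100 * lam, 45 / 100 * lam, 475 / 1000 * lam, 0, by norm_num,
      by norm_num, by positivity, ?_, ?_, by positivity, by linarith,
      Or.inr ⟨rfl, by linarith⟩, ?_⟩
    · rw [gammaConst, if_neg (lt_irrefl _)]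
      have h1 : (1.4142 : ℝ) < Real.sqrt 2 := Real.lt_sqrt_of_sq_lt (by norm_num)
      have h2 : Real.sqrt 2 < 1.5 := (Real.sqrt_lt' (by norm_num)).2 (by norm_num)
      have h3 : 0 < 3 - 2 * Real.sqrt 2 := by linarith
      calc (3 - 2 * Real.sqrt 2) * (lam' / 2) ≤ (3 - 2 * Real.sqrt 2) * (lam / 2) := by gcongr
        _ < 9 / 100 * lam := by nlinarith
    · have h1 : 2 / lam * (9 / 100 * lam) = 18 / 100 := by field_simp; norm_num
      rw [h1]
      have : Real.sqrt (18 / 100) ≤ 0.425 := Real.sqrt_le_iff.2 (by norm_num)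
      linarith
    · intro x _
      norm_num
      linarith

/-- The truncation radius `C (1 + ε + log (1 + 1/ε))` makes Gaussian tails negligible against
`ε ^ 2`. -/
lemma exp_neg_sq_mul_le {κ B a : ℝ} (hκ : 0 < κ) (hB : 0 ≤ B) (ha : 0 < a) :
    ∃ C₀ : ℝ, ∀ C, C₀ ≤ C → ∀ ε, 0 < ε →
      Real.exp (-(κ * (C * (1 + ε + Real.log (1 + 1 / ε))) ^ 2)) * B ≤ a * ε ^ 2 := by
  -- `1` gives `C ≤ C ^ 2`; `2 / κ` produces `exp (-2 l) ≤ ε ^ 2`; `B / (a * κ)` absorbs `B` through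
  -- `x ≤ exp x`.
  refine ⟨max 1 (max (2 / κ) (B / (a * κ))), fun C hC ε hε => ?_⟩
  have hC1 : 1 ≤ C := (le_max_left _ _).trans hC
  have hC2 : 2 / κ ≤ C := (le_max_left _ _).trans ((le_max_right _ _).trans hC)
  have hC3 : B / (a * κ) ≤ C := (le_max_right _ _).trans ((le_max_right _ _).trans hC)
  have hl : 0 ≤ Real.log (1 + 1 / ε) :=
    Real.log_nonneg (by have : 0 < 1 / ε := by positivity
                        linarith)
  set l := Real.log (1 + 1 / ε) with hldef
  have hCC : C ≤ C ^ 2 := by nlinarith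
  have h1 : κ * C * 1 + 2 * l ≤ κ * (C * (1 + ε + l)) ^ 2 := by
    have h2 : 2 ≤ κ * C := by rw [div_le_iff₀ hκ] at hC2; linarith
    have h3 : 1 + l ≤ (1 + ε + l) ^ 2 := by nlinarith [mul_nonneg hε.le hl]
    calc κ * C * 1 + 2 * l ≤ κ * C * 1 + κ * C * l := by gcongr
      _ = κ * C * (1 + l) := by ring
      _ ≤ κ * C ^ 2 * (1 + ε + l) ^ 2 := by gcongr
      _ = _ := by ring
  have h4 : Real.exp (-(2 * l)) ≤ ε ^ 2 := by
    have h5 : Real.exp l = 1 + 1 / ε := Real.exp_log (by positivity)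
    have h6 : Real.exp (-l) ≤ ε := by
      rw [Real.exp_neg, h5, inv_le_comm₀ (by positivity) hε, ← one_div]
      linarith
    calc Real.exp (-(2 * l)) = Real.exp (-l) ^ 2 := by rw [← Real.exp_nat_mul]; congr 1; push_cast; ring
      _ ≤ ε ^ 2 := by gcongr
  have h7 : Real.exp (-(κ * C)) * B ≤ a := by
    have h8 : B ≤ a * (κ * C) := by
      rw [div_le_iff₀ (by positivity)] at hC3
      linarith
    have h9 : κ * C ≤ Real.exp (κ * C) := by linarith [Real.add_one_le_exp (κ * C)]
    rw [Real.exp_neg, ← div_eq_inv_mul, div_le_iff₀ (Real.exp_pos _)]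
    exact h8.trans (by gcongr)
  calc Real.exp (-(κ * (C * (1 + ε + l)) ^ 2)) * B
      ≤ Real.exp (-(κ * C) + -(2 * l)) * B := by gcongr; linarith
    _ = (Real.exp (-(κ * C)) * B) * Real.exp (-(2 * l)) := by rw [Real.exp_add]; ring
    _ ≤ a * ε ^ 2 := by gcongr

/-- The number of cells, times `log (n + 1)`, is negligible against `n ε ^ 2`. -/
lemma card_mul_log_le (d : ℕ) {d' : ℝ} (hd' : (d : ℝ) < d') {b C a : ℝ} (hb : 0 < b) (hC : 0 < C)
    (ha : 0 < a) :
    ∃ N₀ : ℝ, ∀ N, N₀ ≤ N → ∀ (ε : ℝ) (n : ℕ), 0 < ε →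
      N * max (ε ^ (-(d' + 2))) 1 ≤ (n : ℝ) →
      ((b * (C * (1 + ε + Real.log (1 + 1 / ε)) / ε) + 3) ^ d + 1) * Real.log (n + 1) ≤
        a * (n * ε ^ 2) ∧ N ≤ n * ε ^ 2 := by
  have hd0 : (0 : ℝ) ≤ d := by positivity
  set g : ℝ := d' - d with hg
  have hg0 : 0 < g := by rw [hg]; linarith
  -- Half of the gap `g = d' - d` pays for `log (1 + 1/ε)` in the radius, through `v ^ β`; the other
  -- half pays for `log (n + 1)`, through `n ^ r`.
  set β : ℝ := g / (2 * (d + 1)) with hβ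
  have hβ0 : 0 < β := by positivity
  have hβd : β * d ≤ g / 2 := by
    rw [hβ, div_mul_eq_mul_div, div_le_div_iff₀ (by positivity) (by positivity)]
    nlinarith
  set r : ℝ := g / (2 * (d' + 2)) with hr
  have hd'0 : 0 < d' + 2 := by linarith
  have hr0 : 0 < r := by positivity
  have hr2 : r ≤ 1 / 2 := by
    rw [hr, div_le_div_iff₀ (by positivity) (by positivity)]
    linarith
  have hrd : (d' + 2) * (1 - r) = d + 2 + g / 2 := by
    rw [hr]; field_simp; rw [hg]; ring
  set c₁ : ℝ := b * C * (2 + 2 ^ β / β) + 3 with hc₁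
  have hc₁0 : 0 < c₁ := by positivity
  set c₂ : ℝ := (c₁ ^ d + 1) * (2 ^ r / r) with hc₂
  have hc₂0 : 0 < c₂ := by positivity
  refine ⟨max 1 ((c₂ / a) ^ 2), fun N hN ε n hε hn => ?_⟩
  have hN1 : 1 ≤ N := (le_max_left _ _).trans hN
  have hN2 : (c₂ / a) ^ 2 ≤ N := (le_max_right _ _).trans hN
  set v : ℝ := max (1 / ε) 1 with hv
  have hv1 : 1 ≤ v := le_max_right _ _
  have hv0 : 0 < v := by linarith
  have hvε : 1 / ε ≤ v := le_max_left _ _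
  have hvpow : v ^ (d' + 2) ≤ max (ε ^ (-(d' + 2))) 1 := by
    rcases le_total (1 / ε) 1 with h | h
    · rw [hv, max_eq_right h, Real.one_rpow]; exact le_max_right _ _
    · rw [hv, max_eq_left h, one_div, Real.inv_rpow hε.le, ← Real.rpow_neg hε.le]
      exact le_max_left _ _
  have hnv : N * v ^ (d' + 2) ≤ n := (by gcongr : _ ≤ N * max (ε ^ (-(d' + 2))) 1).trans hn
  have hv1' : 1 ≤ v ^ (d' + 2) := Real.one_le_rpow hv1 hd'0.le
  have hn1 : (1 : ℝ) ≤ n := by nlinarith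
  have hn0 : (0 : ℝ) < n := by linarith
  have hε2 : 1 ≤ v ^ 2 * ε ^ 2 := by
    rw [← mul_pow]
    refine one_le_pow₀ ?_
    rwa [div_le_iff₀ hε] at hvε
  constructor
  · have hlog0 : 0 ≤ Real.log (1 + 1 / ε) := Real.log_nonneg (by
      have : 0 < 1 / ε := by positivity
      linarith)
    have hlog : Real.log (1 + 1 / ε) ≤ 2 ^ β / β * v ^ β := by
      refine (Real.log_le_rpow_div (by positivity) hβ0).trans ?_
      rw [div_mul_eq_mul_div, ← Real.mul_rpow (by norm_num) hv0.le]
      gcongr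
      linarith
    have hvβ : 1 ≤ v ^ β := Real.one_le_rpow hv1 hβ0.le
    have hv1β : v ^ (1 + β) = v * v ^ β := by rw [Real.rpow_add hv0, Real.rpow_one]
    have hradius : (1 + ε + Real.log (1 + 1 / ε)) / ε ≤ (2 + 2 ^ β / β) * v ^ (1 + β) := by
      have e : (1 + ε + Real.log (1 + 1 / ε)) / ε =
          1 / ε + 1 + 1 / ε * Real.log (1 + 1 / ε) := by field_simp
      rw [e, hv1β]
      have h1 : v ≤ v * v ^ β := by nlinarith
      have h2 : 1 / ε * Real.log (1 + 1 / ε) ≤ v * (2 ^ β / β * v ^ β) := by gcongr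
      linarith
    have hbase : b * (C * (1 + ε + Real.log (1 + 1 / ε)) / ε) + 3 ≤ c₁ * v ^ (1 + β) := by
      have h1 : 1 ≤ v ^ (1 + β) := Real.one_le_rpow hv1 (by linarith)
      calc _ = b * C * ((1 + ε + Real.log (1 + 1 / ε)) / ε) + 3 := by ring
        _ ≤ b * C * ((2 + 2 ^ β / β) * v ^ (1 + β)) + 3 * v ^ (1 + β) := by
            gcongr; linarith
        _ = _ := by rw [hc₁]; ring
    have hcard : (b * (C * (1 + ε + Real.log (1 + 1 / ε)) / ε) + 3) ^ d + 1 ≤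
        (c₁ ^ d + 1) * v ^ ((1 + β) * d) := by
      have h1 : 1 ≤ v ^ ((1 + β) * d) := Real.one_le_rpow hv1 (by positivity)
      calc _ ≤ (c₁ * v ^ (1 + β)) ^ d + v ^ ((1 + β) * d) := by gcongr
        _ = _ := by
            rw [mul_pow, ← Real.rpow_natCast (v ^ (1 + β)) d, ← Real.rpow_mul hv0.le]; ring
    have hlogn : Real.log (n + 1) ≤ 2 ^ r / r * (n : ℝ) ^ r := by
      refine (Real.log_le_rpow_div (by positivity) hr0).trans ?_
      rw [div_mul_eq_mul_div, ← Real.mul_rpow (by norm_num) hn0.le]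
      gcongr
      linarith
    have hlogn0 : 0 ≤ Real.log ((n : ℝ) + 1) := Real.log_nonneg (by linarith)
    have hNr : c₂ / a ≤ N ^ (1 - r) := by
      calc c₂ / a = Real.sqrt ((c₂ / a) ^ 2) := (Real.sqrt_sq (by positivity)).symm
        _ ≤ Real.sqrt N := Real.sqrt_le_sqrt hN2
        _ = N ^ (1 / 2 : ℝ) := Real.sqrt_eq_rpow N
        _ ≤ N ^ (1 - r) := Real.rpow_le_rpow_of_exponent_le hN1 (by linarith)
    have hnr : c₂ * (v ^ ((1 + β) * d) * v ^ 2) ≤ a * (n : ℝ) ^ (1 - r) := by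
      have h1 : N ^ (1 - r) * v ^ ((d' + 2) * (1 - r)) ≤ (n : ℝ) ^ (1 - r) := by
        rw [Real.rpow_mul hv0.le, ← Real.mul_rpow (by linarith) (by positivity)]
        exact Real.rpow_le_rpow (by positivity) hnv (by linarith)
      have h2 : v ^ ((1 + β) * d) * v ^ 2 ≤ v ^ ((d' + 2) * (1 - r)) := by
        rw [← Real.rpow_two, ← Real.rpow_add hv0, hrd]
        refine Real.rpow_le_rpow_of_exponent_le hv1 ?_
        linarith
      calc c₂ * (v ^ ((1 + β) * d) * v ^ 2)
          = a * (c₂ / a * (v ^ ((1 + β) * d) * v ^ 2)) := by field_simp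
        _ ≤ a * (N ^ (1 - r) * v ^ ((d' + 2) * (1 - r))) := by gcongr
        _ ≤ _ := by gcongr
    have hn1r : (n : ℝ) ^ (1 - r) * (n : ℝ) ^ r = n := by
      rw [← Real.rpow_add hn0]; simp
    calc _ ≤ (c₁ ^ d + 1) * v ^ ((1 + β) * d) * (2 ^ r / r * (n : ℝ) ^ r) := by gcongr
      _ = c₂ * v ^ ((1 + β) * d) * (n : ℝ) ^ r * 1 := by rw [hc₂]; ring
      _ ≤ c₂ * v ^ ((1 + β) * d) * (n : ℝ) ^ r * (v ^ 2 * ε ^ 2) := by gcongr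
      _ = c₂ * (v ^ ((1 + β) * d) * v ^ 2) * (n : ℝ) ^ r * ε ^ 2 := by ring
      _ ≤ a * (n : ℝ) ^ (1 - r) * (n : ℝ) ^ r * ε ^ 2 := by gcongr
      _ = a * ((n : ℝ) ^ (1 - r) * (n : ℝ) ^ r) * ε ^ 2 := by ring
      _ = _ := by rw [hn1r]; ring
  · have h1 : v ^ 2 ≤ v ^ (d' + 2) := by
      rw [← Real.rpow_two]
      exact Real.rpow_le_rpow_of_exponent_le hv1 (by linarith)
    calc N = N * 1 := (mul_one N).symm
      _ ≤ N * (v ^ 2 * ε ^ 2) := by gcongr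
      _ ≤ N * (v ^ (d' + 2) * ε ^ 2) := by gcongr
      _ = N * v ^ (d' + 2) * ε ^ 2 := by ring
      _ ≤ n * ε ^ 2 := by gcongr

/-- Absorption of the error terms in the exponential rate. -/
lemma exp_add_mul_exp_le {A a A' n ε τ u K : ℝ} {k : ℕ} (hn : 0 ≤ n) (hk : (k : ℝ) ≤ K)
    (hu : A * ε ^ 2 ≤ u) (hτ : τ ≤ a * ε ^ 2) (hK : K * Real.log (n + 1) ≤ a * (n * ε ^ 2))
    (haA : A' + 4 * a ≤ A) (hnε : 1 ≤ 2 * a * (n * ε ^ 2)) :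
    Real.exp (-(n * (u - τ))) + (n + 1) ^ k * Real.exp (-(n * (A * ε ^ 2 - τ))) ≤
      Real.exp (-(A' * n * ε ^ 2)) := by
  have hlog : 0 ≤ Real.log (n + 1) := Real.log_nonneg (by linarith)
  have hpow : (n + 1) ^ k ≤ Real.exp (a * (n * ε ^ 2)) := by
    have h1 : (n + 1) ^ k = Real.exp (k * Real.log (n + 1)) := by
      rw [Real.exp_nat_mul, Real.exp_log (by linarith)]
    rw [h1]
    exact Real.exp_le_exp.2 ((by gcongr : (k : ℝ) * Real.log (n + 1) ≤ K * Real.log (n + 1)).trans hK)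
  have hnε0 : 0 ≤ n * ε ^ 2 := by positivity
  -- Of the reserve `4 * a`, one `a` covers `τ`, one the number of types, and the remaining two a
  -- factor `exp (-1)` in each term; two such terms fit since `2 ≤ exp 1`.
  have h4 : (A' + 4 * a) * (n * ε ^ 2) ≤ A * (n * ε ^ 2) := by gcongr
  have hna : 0 ≤ a * (n * ε ^ 2) := by linarith
  have h2 : Real.exp (-(n * (u - τ))) ≤ Real.exp (-(A' * n * ε ^ 2) - 1) := by
    refine Real.exp_le_exp.2 ?_
    have h3 : n * (A * ε ^ 2 - a * ε ^ 2) ≤ n * (u - τ) := by gcongr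
    linarith
  have h3 : (n + 1) ^ k * Real.exp (-(n * (A * ε ^ 2 - τ))) ≤
      Real.exp (-(A' * n * ε ^ 2) - 1) := by
    calc _ ≤ Real.exp (a * (n * ε ^ 2)) * Real.exp (-(n * (A * ε ^ 2 - τ))) := by gcongr
      _ = Real.exp (a * (n * ε ^ 2) + -(n * (A * ε ^ 2 - τ))) := (Real.exp_add _ _).symm
      _ ≤ _ := by
        refine Real.exp_le_exp.2 ?_
        have h5 : n * (A * ε ^ 2 - a * ε ^ 2) ≤ n * (A * ε ^ 2 - τ) := by gcongr
        linarith
  have h5 : 2 * Real.exp (-(A' * n * ε ^ 2) - 1) ≤ Real.exp (-(A' * n * ε ^ 2)) := by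
    rw [Real.exp_sub]
    have : 2 ≤ Real.exp 1 := by linarith [Real.add_one_le_exp (1 : ℝ)]
    rw [mul_div_assoc', div_le_iff₀ (Real.exp_pos _)]
    nlinarith [Real.exp_pos (-(A' * n * ε ^ 2))]
  linarith

end Parameters

/-! ### Assembly of the theorem. -/

theorem mainTheorem4 (d : ℕ) (p : ℝ) (hp1 : 1 ≤ p) (hp2 : p ≤ 2)
    (lam : ℝ) (hlam : 0 < lam) (α : ℝ) (hα : 0 < α) (E : ℝ≥0)
    (d' : ℝ) (hd' : (d : ℝ) < d') (lam' : ℝ) (hlam' : lam' < lam) :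
    ∃ N₀ : ℕ, 0 < N₀ ∧
      ∀ (Ω : Type*) [MeasurableSpace Ω] (P : Measure Ω) [IsProbabilityMeasure P]
        (X : ℕ → Ω → EuclideanSpace ℝ (Fin d)),
        (∀ i, Measurable (X i)) →
        iIndepFun X P →
        sqExpMoment P α X = (E : ℝ≥0∞) →
        (∀ n : ℕ, 1 ≤ n → SatisfiesTalagrand p lam (averagedLaw P n X)) →
        ∀ (ε : ℝ) (n : ℕ), 0 < ε → (N₀ : ℝ) * max (ε ^ (-(d' + 2))) 1 ≤ (n : ℝ) →
          P {ω | ENNReal.ofReal ε <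
              wassersteinDist p (empiricalMeasure n (fun i => X i ω)) (averagedLaw P n X)} ≤
            ENNReal.ofReal (Real.exp (-(gammaConst p * (lam' / 2) * (n : ℝ) * ε ^ 2))) := by
  obtain ⟨s, s', A, θ, θ', ρ, hs, hs', hA, hAgt, hsum, hθ, hθθ', hcase, hρ⟩ :=
    exists_rate_parameters hp1 hp2 hlam hα hlam'
  set M : ℝ := 1 + E / α with hMdef
  have hM1 : 1 ≤ M := by
    have : 0 ≤ (E : ℝ) / α := by positivity
    linarith
  -- One constant for both sources of exponential moments: the hypothesis on `E` when `θ' = α`,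
  -- Talagrand's inequality when `p = 2`. The unused summand is nonnegative whatever the sign of
  -- `lam / 2 - θ'`.
  set B : ℝ := E + Real.exp (θ' * (lam / 2) * M ^ 2 / (lam / 2 - θ')) with hB
  have hB0 : 0 ≤ B := by positivity
  set a : ℝ := (A - gammaConst p * (lam' / 2)) / 4 with ha
  have ha0 : 0 < a := by rw [ha]; linarith
  obtain ⟨C₀, hC₀⟩ := exp_neg_sq_mul_le (sub_pos.2 hθθ') hB0 ha0
  -- `C₀` controls the tail `τ`, `10 * M` gives `1 + M / R ≤ 11 / 10`, and `ρ` makes `R / ε` large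
  -- enough for the outer rate.
  set C : ℝ := max C₀ (max (10 * M) ρ) with hC
  have hC1 : C₀ ≤ C := le_max_left _ _
  have hC2 : 10 * M ≤ C := (le_max_left _ _).trans (le_max_right _ _)
  have hC3 : ρ ≤ C := (le_max_right _ _).trans (le_max_right _ _)
  have hC0 : 0 < C := by linarith
  obtain ⟨N₁, hN₁⟩ := card_mul_log_le d hd' (b := 2 * (d + 1) / s') (by positivity) hC0 ha0
  refine ⟨⌈max N₁ (1 / (2 * a))⌉₊ + 1, Nat.succ_pos _, ?_⟩
  intro Ω _ P _ X hX hind hE hT ε n hε hn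
  set N : ℕ := ⌈max N₁ (1 / (2 * a))⌉₊ + 1
  have hNle : max N₁ (1 / (2 * a)) ≤ N := by
    push_cast [N]
    linarith [Nat.le_ceil (max N₁ (1 / (2 * a)))]
  obtain ⟨hcard, hnε⟩ := hN₁ N ((le_max_left _ _).trans hNle) ε n hε hn
  have hn0 : n ≠ 0 := by
    rintro rfl
    have : (0 : ℝ) < N := by positivity
    simp only [Nat.cast_zero, zero_mul] at hnε
    linarith
  have hμ := isProbabilityMeasure_averagedLaw (P := P) hX hn0
  have hTn := hT n (Nat.one_le_iff_ne_zero.2 hn0)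
  set μ := averagedLaw P n X with hμdef
  have hEμ : ∫⁻ x, ENNReal.ofReal (Real.exp (α * ‖x‖ ^ 2)) ∂μ ≤ E :=
    lintegral_averagedLaw_exp_le hX hn0 hE.le
  have hMμ := lintegral_enorm_rpow_le hp1 hp2 hα hEμ
  have hBμ : ∫⁻ x, ENNReal.ofReal (Real.exp (θ' * ‖x‖ ^ 2)) ∂μ ≤ ENNReal.ofReal B := by
    rcases hcase with h | ⟨h2, hlt⟩
    · rw [h]
      refine hEμ.trans ?_
      rw [← ENNReal.ofReal_coe_nnreal]
      refine ENNReal.ofReal_le_ofReal ?_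
      rw [hB]
      linarith [Real.exp_pos (θ' * (lam / 2) * M ^ 2 / (lam / 2 - θ'))]
    · rw [h2] at hTn hMμ
      refine (lintegral_exp_sq_le hTn (by linarith) hMμ (hθ.trans hθθ') hlt).trans ?_
      refine ENNReal.ofReal_le_ofReal ?_
      rw [hB]
      linarith [E.coe_nonneg]
  have hl : 0 ≤ Real.log (1 + 1 / ε) := Real.log_nonneg (by
    have : 0 < 1 / ε := by positivity
    linarith)
  set R : ℝ := C * (1 + ε + Real.log (1 + 1 / ε)) with hR
  have hRC : C ≤ R := by nlinarith [mul_nonneg hC0.le (add_nonneg hε.le hl)]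
  have hRε : C * ε ≤ R := by nlinarith [mul_nonneg hC0.le (add_nonneg zero_le_one hl)]
  have hR0 : 0 < R := by linarith
  have hMR : 1 + M / R ≤ 11 / 10 := by
    have : M / R ≤ 1 / 10 := by rw [div_le_iff₀ hR0]; linarith
    linarith
  set τ : ℝ := Real.exp (-((θ' - θ) * R ^ 2)) * B with hτ
  have hτ0 : 0 ≤ τ := by positivity
  have hτle : τ ≤ a * ε ^ 2 := hC₀ C hC1 ε hε
  obtain ⟨J, _, _, q, o, hq, ho, hδ, hJ⟩ := exists_cells d hR0 (mul_pos hs' hε)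
  -- The outer allowance is `η = s / (11 / 10) * ε`, so that the factor `1 + M / R` brings it back
  -- to at most `s * ε`.
  have hbudget : s' * ε + (1 + M / R) * (s / (11 / 10) * ε) +
      Real.sqrt (2 / lam * (A * ε ^ 2)) ≤ ε := by
    have h1 : Real.sqrt (2 / lam * (A * ε ^ 2)) = Real.sqrt (2 / lam * A) * ε := by
      rw [← mul_assoc, Real.sqrt_mul (by positivity), Real.sqrt_sq hε.le]
    have h2 : (1 + M / R) * (s / (11 / 10) * ε) ≤ 11 / 10 * (s / (11 / 10) * ε) := by gcongr
    have h3 : 11 / 10 * (s / (11 / 10) * ε) = s * ε := by ring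
    rw [h1]
    calc _ ≤ s' * ε + s * ε + Real.sqrt (2 / lam * A) * ε := by linarith
      _ = (s + s' + Real.sqrt (2 / lam * A)) * ε := by ring
      _ ≤ 1 * ε := by gcongr
      _ = ε := one_mul ε
  refine (measure_lt_wassersteinDist_le_of_cells hp1 hp2 hX hind hn0 hlam hTn hq hR0 ho
    (by positivity) hδ (by linarith) hMμ (by positivity) hbudget hθ.le hτ0
    (setLIntegral_exp_le hR0.le hθθ'.le hBμ)).trans (ENNReal.ofReal_le_ofReal ?_)
  refine exp_add_mul_exp_le (a := a) n.cast_nonneg hJ ?_ hτle ?_ ?_ ?_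
  · have h1 := hρ (R / ε) (hC3.trans ((le_div_iff₀ hε).2 hRε))
    have h2 : θ * (s / (11 / 10) * ε) ^ p * R ^ (2 - p) =
        θ * (s / (11 / 10)) ^ p * (R / ε) ^ (2 - p) * ε ^ 2 := by
      rw [Real.mul_rpow (by positivity) hε.le, Real.div_rpow hR0.le hε.le, ← Real.rpow_two,
        Real.rpow_sub hε]
      field_simp
    rw [h2]
    gcongr
  · convert hcard using 4
    field_simp
  · rw [ha]; linarith
  · have h1 : 1 / (2 * a) ≤ n * ε ^ 2 := ((le_max_right _ _).trans hNle).trans hnε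
    rw [div_le_iff₀ (by positivity)] at h1
    linarith
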